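/- Let $n\ge 1$, $s\in(0,1)$, and let $\Omega\subset\mathbb R^n$ be a non-empty bounded open set with Lipschitz ($C^{0,1}$) boundary, $\Omega^c=\mathbb R^n\setminus\Omega$. Let $g:[0,\infty)\to[0,\infty)$ be continuous and nondecreasing with $g(0)=0$, $g(t)>0$ for $t>0$ and $g(t)\to\infty$ as $t\to\infty$, and let $G(t)=\int_0^t g(\tau)\,d\tau$ (so $G'=g$). Assume that for some constants $p^\pm$ $$1<p^-\le \frac{t\,g(t)}{G(t)}\le p^+<\infty\qquad\text{for all } t>0 .$$ Let $\beta\in L^\infty(\Omega^c)$ with $\beta>0$ a.e. in $\Omega^c$. Write $D_su(x,y)=\frac{u(x)-u(y)}{|x-y|^s}$, $d\nu=\frac{dx\,dy}{|x-y|^n}$, $\mathbb{R}^{2n}_\Omega=\mathbb R^{2n}\setminus(\Omega^c)^2$, and read $g(|t|)\frac{t}{|t|}$ as $0$ at $t=0$. For $S\subset\mathbb R^{2n}$ and $A\subset\mathbb R^n$ put $$\Phi_{S}(u)=\iint_S G(|D_su|)\,d\nu,\qquad \mathcal E_S(u,v)=\iint_S g(|D_su|)\frac{D_su}{|D_su|}D_sv\,d\nu,$$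 $$\Phi_{G,A}(u)=\int_A G(|u|)\,dx,\qquad \Phi_{G,\beta,\Omega^c}(u)=\int_{\Omega^c}\beta\, G(|u|)\,dx .$$ Consider the following spaces of measurable functions: * $W^{s,G}_0(\Omega)$: $u$ on $\mathbb R^n$ with $\Phi_{G,\mathbb R^n}(u)+\Phi_{\mathbb R^{2n}}(u)<\infty$ and $u=0$ a.e. in $\Omega^c$; * $W^{s,G}_*(\Omega)$: $u$ on $\mathbb R^n$ with $\Phi_{G,\Omega}(u)+\Phi_{\mathbb{R}^{2n}_\Omega}(u)<\infty$; * $W^{s,G}_{reg}(\Omega)$: $u$ on $\Omega$ with $\Phi_{G,\Omega}(u)+\Phi_{\Omega\times\Omega}(u)<\infty$; * $\mathcal X$: $u\in W^{s,G}_*(\Omega)$ with $\Phi_{G,\beta,\Omega^c}(u)<\infty$. A number $\lambda$ is an eigenvalue with eigenfunction $u$ of * the Dirichlet problem if $u\in W^{s,G}_0(\Omega)$ and $\mathcal E_{\mathbb R^{2n}}(u,v)=(\lambda-1)\int_\Omega g(|u|)\frac{u}{|u|}v\,dx$ for all $v\in W^{s,G}_0(\Omega)$; * the Neumann problem if $u\in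 W^{s,G}_*(\Omega)$ and $\frac12\mathcal E_{\mathbb{R}^{2n}_\Omega}(u,v)=(\lambda-1)\int_\Omega g(|u|)\frac{u}{|u|}v\,dx$ for all $v\in W^{s,G}_*(\Omega)$; * the regional Neumann problem if $u\in W^{s,G}_{reg}(\Omega)$ and $\mathcal E_{\Omega\times\Omega}(u,v)=(\lambda-1)\int_\Omega g(|u|)\frac{u}{|u|}v\,dx$ for all $v\in W^{s,G}_{reg}(\Omega)$; * the Robin problem if $u\in\mathcal X$ and $\frac12\mathcal E_{\mathbb{R}^{2n}_\Omega}(u,v)=(\lambda-1)\int_\Omega g(|u|)\frac{u}{|u|}v\,dx-\int_{\Omega^c}\beta\, g(|u|)\frac{u}{|u|}v\,dx$ for all $v\in\mathcal X$. **Theorem.** For every $\mu>0$ there are positive numbers $\lambda_D,\lambda_N,\lambda_{\tilde N},\lambda_R$ which are eigenvalues of the Dirichlet, Neumann, regional Neumann and Robin problem, respectively, with non-negative eigenfunctions $u_D\in W^{s,G}_0(\Omega)$, $u_N\in W^{s,G}_*(\Omega)$, $u_{\tilde N}\in W^{s,G}_{reg}(\Omega)$ and $u_R\in\mathcal X$,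 respectively, such that $$\Phi_{G,\Omega}(u_D)=\Phi_{G,\Omega}(u_N)=\Phi_{G,\Omega}(u_{\tilde N})=\Phi_{G,\Omega}(u_R)=\mu .$$ Moreover, these eigenfunctions can be chosen as minimizers: among all functions $u$ with $\Phi_{G,\Omega}(u)=\mu$ in the respective space, $u_D$, $u_N$, $u_{\tilde N}$, $u_R$ minimize, respectively, $$\frac{\Phi_{\mathbb R^{2n}}(u)+\Phi_{G,\Omega}(u)}{\Phi_{G,\Omega}(u)},\quad \frac{\Phi_{\mathbb{R}^{2n}_\Omega}(u)+\Phi_{G,\Omega}(u)}{\Phi_{G,\Omega}(u)},\quad \frac{\Phi_{\Omega\times\Omega}(u)+\Phi_{G,\Omega}(u)}{\Phi_{G,\Omega}(u)},\quad \frac{\Phi_{\mathbb{R}^{2n}_\Omega}(u)+\Phi_{G,\Omega}(u)+2\,\Phi_{G,\beta,\Omega^c}(u)}{\Phi_{G,\Omega}(u)}.$$ -/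

import Mathlib

open MeasureTheory Set Filter Topology
open scoped ENNReal NNReal

namespace FracOrlicz

noncomputable section

/-- The Euclidean space `ℝⁿ`. -/
abbrev Rn (n : ℕ) : Type := EuclideanSpace ℝ (Fin n)

/-! ### Young functions -/

/-- The conditions on the density `g : [0,∞) → [0,∞)` of a Young function `G(t) = ∫₀ᵗ g`.
Only the values of `g` on `[0,∞)` matter. -/
structure IsYoungDensity (g : ℝ → ℝ) : Prop where
  zero : g 0 = 0
  pos : ∀ t : ℝ, 0 < t → 0 < g t
  mono : MonotoneOn g (Ici 0)
  right_cont : ∀ t : ℝ, 0 ≤ t → ContinuousWithinAt g (Ici t) t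
  tendsto : Tendsto g atTop atTop

/-- The Young function `G(t) = ∫₀ᵗ g(τ) dτ` with density `g`. -/
def young (g : ℝ → ℝ) (t : ℝ) : ℝ := ∫ τ in (0 : ℝ)..t, g τ

/-- The growth condition `1 < p⁻ ≤ t g(t) / G(t) ≤ p⁺ < ∞` for all `t > 0`. -/
structure GrowthCondition (g : ℝ → ℝ) (pm pp : ℝ) : Prop where
  one_lt : 1 < pm
  lower : ∀ t : ℝ, 0 < t → pm ≤ t * g t / young g t
  upper : ∀ t : ℝ, 0 < t → t * g t / young g t ≤ pp

/-- The odd function `t ↦ g(|t|) t / |t|`, with value `0` at `t = 0`. -/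
def oddExt (g : ℝ → ℝ) (t : ℝ) : ℝ := g |t| * (t / |t|)

/-! ### Domains -/

/-- `Ω` has a Lipschitz (`C^{0,1}`) boundary: near each boundary point, `Ω` is, in the direction of
some unit vector `e`, the region strictly above the graph of a Lipschitz function of the
component orthogonal to `e`. -/
def HasLipschitzBoundary {n : ℕ} (Ω : Set (Rn n)) : Prop :=
  ∀ x₀ ∈ frontier Ω, ∃ (e : Rn n) (r : ℝ) (K : ℝ≥0) (γ : Rn n → ℝ),
    ‖e‖ = 1 ∧ 0 < r ∧ LipschitzWith K γ ∧
    ∀ x ∈ Metric.ball x₀ r, (x ∈ Ω ↔ γ (x - inner ℝ e x • e) < inner ℝ e x)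

/-! ### Modulars and forms -/

/-- The `s`-Hölder quotient `D_s u(x,y) = (u(x) - u(y)) / |x - y|^s`. -/
def holderQuot {n : ℕ} (s : ℝ) (u : Rn n → ℝ) (p : Rn n × Rn n) : ℝ :=
  (u p.1 - u p.2) / ‖p.1 - p.2‖ ^ s

/-- The measure `dx dy / |x - y|^n` on `ℝⁿ × ℝⁿ` (for `n ≥ 1` the diagonal is Lebesgue-null, so the
value given to the density there is irrelevant). -/
def pairMeasure (n : ℕ) : Measure (Rn n × Rn n) :=
  (volume : Measure (Rn n × Rn n)).withDensity
    fun p => ENNReal.ofReal (1 / ‖p.1 - p.2‖ ^ n)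

/-- `∫_A G(|u|) dx`. -/
def modular {n : ℕ} (g : ℝ → ℝ) (A : Set (Rn n)) (u : Rn n → ℝ) : ℝ≥0∞ :=
  ∫⁻ x in A, ENNReal.ofReal (young g |u x|)

/-- `∫_A β G(|u|) dx`. -/
def weightedModular {n : ℕ} (g : ℝ → ℝ) (β : Rn n → ℝ) (A : Set (Rn n)) (u : Rn n → ℝ) : ℝ≥0∞ :=
  ∫⁻ x in A, ENNReal.ofReal (β x * young g |u x|)

/-- `∬_S G(|D_s u|) dx dy / |x - y|^n`. -/
def pairModular {n : ℕ} (g : ℝ → ℝ) (s : ℝ) (S : Set (Rn n × Rn n)) (u : Rn n → ℝ) : ℝ≥0∞ :=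
  ∫⁻ p in S, ENNReal.ofReal (young g |holderQuot s u p|) ∂(pairMeasure n)

/-- `∬_S g(|D_s u|) (D_s u / |D_s u|) D_s v dx dy / |x - y|^n`. -/
def pairForm {n : ℕ} (g : ℝ → ℝ) (s : ℝ) (S : Set (Rn n × Rn n)) (u v : Rn n → ℝ) : ℝ :=
  ∫ p in S, oddExt g (holderQuot s u p) * holderQuot s v p ∂(pairMeasure n)

/-- `∫_A g(|u|) (u / |u|) v dx`. -/
def lowerForm {n : ℕ} (g : ℝ → ℝ) (A : Set (Rn n)) (u v : Rn n → ℝ) : ℝ :=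
  ∫ x in A, oddExt g (u x) * v x

/-- `∫_A β g(|u|) (u / |u|) v dx`. -/
def weightedForm {n : ℕ} (g : ℝ → ℝ) (β : Rn n → ℝ) (A : Set (Rn n)) (u v : Rn n → ℝ) : ℝ :=
  ∫ x in A, β x * oddExt g (u x) * v x

/-- The set `ℝ²ⁿ ∖ (Ωᶜ)²`. -/
def starSet {n : ℕ} (Ω : Set (Rn n)) : Set (Rn n × Rn n) := (Ωᶜ ×ˢ Ωᶜ)ᶜ

/-- `⟨(-Δ_g)^s u, v⟩`. -/
def fullPairing {n : ℕ} (g : ℝ → ℝ) (s : ℝ) (u v : Rn n → ℝ) : ℝ :=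
  pairForm g s univ u v

/-- `⟨(-Δ_g)^s u, v⟩_*`, with the factor `1/2`. -/
def starPairing {n : ℕ} (g : ℝ → ℝ) (s : ℝ) (Ω : Set (Rn n)) (u v : Rn n → ℝ) : ℝ :=
  1 / 2 * pairForm g s (starSet Ω) u v

/-- `⟨(-Δ_g)^s_Ω u, v⟩`, for the regional operator. -/
def regPairing {n : ℕ} (g : ℝ → ℝ) (s : ℝ) (Ω : Set (Rn n)) (u v : Rn n → ℝ) : ℝ :=
  pairForm g s (Ω ×ˢ Ω) u v

/-! ### Function spaces

Elements are represented by functions on `ℝⁿ`. Under the growth condition the integrands of the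
pairings above are absolutely integrable for `u`, `v` in the corresponding space. -/

/-- `W^{s,G}_0(Ω)`: functions of `W^{s,G}(ℝⁿ)` that vanish a.e. outside `Ω`. -/
def dirichletSpace {n : ℕ} (g : ℝ → ℝ) (s : ℝ) (Ω : Set (Rn n)) : Set (Rn n → ℝ) :=
  {u | AEMeasurable u volume ∧ modular g univ u < ∞ ∧ pairModular g s univ u < ∞ ∧
    ∀ᵐ x ∂(volume.restrict Ωᶜ), u x = 0}

/-- `W^{s,G}_*(Ω)`. -/
def neumannSpace {n : ℕ} (g : ℝ → ℝ) (s : ℝ) (Ω : Set (Rn n)) : Set (Rn n → ℝ) :=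
  {u | AEMeasurable u volume ∧ modular g Ω u < ∞ ∧ pairModular g s (starSet Ω) u < ∞}

/-- `W^{s,G}_reg(Ω)`; the values of `u` outside `Ω` play no role. -/
def regionalSpace {n : ℕ} (g : ℝ → ℝ) (s : ℝ) (Ω : Set (Rn n)) : Set (Rn n → ℝ) :=
  {u | AEMeasurable u (volume.restrict Ω) ∧ modular g Ω u < ∞ ∧ pairModular g s (Ω ×ˢ Ω) u < ∞}

/-- The space `𝒳` of the Robin problem. -/
def robinSpace {n : ℕ} (g : ℝ → ℝ) (s : ℝ) (β : Rn n → ℝ) (Ω : Set (Rn n)) : Set (Rn n → ℝ) :=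
  {u | AEMeasurable u volume ∧ modular g Ω u < ∞ ∧ pairModular g s (starSet Ω) u < ∞ ∧
    weightedModular g β Ωᶜ u < ∞}

/-! ### Eigenvalues with eigenfunctions, in the weak sense -/

/-- `lam` is an eigenvalue of the Dirichlet problem with eigenfunction `u`. -/
def IsDirichletEigenpair {n : ℕ} (g : ℝ → ℝ) (s : ℝ) (Ω : Set (Rn n)) (lam : ℝ)
    (u : Rn n → ℝ) : Prop :=
  u ∈ dirichletSpace g s Ω ∧
    ∀ v ∈ dirichletSpace g s Ω, fullPairing g s u v = (lam - 1) * lowerForm g Ω u v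

/-- `lam` is an eigenvalue of the Neumann problem with eigenfunction `u`. -/
def IsNeumannEigenpair {n : ℕ} (g : ℝ → ℝ) (s : ℝ) (Ω : Set (Rn n)) (lam : ℝ)
    (u : Rn n → ℝ) : Prop :=
  u ∈ neumannSpace g s Ω ∧
    ∀ v ∈ neumannSpace g s Ω, starPairing g s Ω u v = (lam - 1) * lowerForm g Ω u v

/-- `lam` is an eigenvalue of the regional Neumann problem with eigenfunction `u`. -/
def IsRegionalEigenpair {n : ℕ} (g : ℝ → ℝ) (s : ℝ) (Ω : Set (Rn n)) (lam : ℝ)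
    (u : Rn n → ℝ) : Prop :=
  u ∈ regionalSpace g s Ω ∧
    ∀ v ∈ regionalSpace g s Ω, regPairing g s Ω u v = (lam - 1) * lowerForm g Ω u v

/-- `lam` is an eigenvalue of the Robin problem with weight `β` and with eigenfunction `u`. -/
def IsRobinEigenpair {n : ℕ} (g : ℝ → ℝ) (s : ℝ) (β : Rn n → ℝ) (Ω : Set (Rn n)) (lam : ℝ)
    (u : Rn n → ℝ) : Prop :=
  u ∈ robinSpace g s β Ω ∧
    ∀ v ∈ robinSpace g s β Ω,
      starPairing g s Ω u v = (lam - 1) * lowerForm g Ω u v - weightedForm g β Ωᶜ u v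

/-! ### Constrained minimization problems -/

/-- The functions of `X` at energy level `μ`, i.e. with `∫_Ω G(|u|) dx = μ`. -/
def level {n : ℕ} (g : ℝ → ℝ) (Ω : Set (Rn n)) (μ : ℝ) (X : Set (Rn n → ℝ)) : Set (Rn n → ℝ) :=
  {u | u ∈ X ∧ modular g Ω u = ENNReal.ofReal μ}

/-- `u` attains the infimum, over the functions of `W^{s,G}_0(Ω)` at level `μ`, of the Dirichlet
quotient. -/
def IsDirichletMinimizer {n : ℕ} (g : ℝ → ℝ) (s : ℝ) (Ω : Set (Rn n)) (μ : ℝ)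
    (u : Rn n → ℝ) : Prop :=
  u ∈ level g Ω μ (dirichletSpace g s Ω) ∧
    IsMinOn (fun w => (pairModular g s univ w + modular g Ω w) / modular g Ω w)
      (level g Ω μ (dirichletSpace g s Ω)) u

/-- The same for the Neumann problem. -/
def IsNeumannMinimizer {n : ℕ} (g : ℝ → ℝ) (s : ℝ) (Ω : Set (Rn n)) (μ : ℝ)
    (u : Rn n → ℝ) : Prop :=
  u ∈ level g Ω μ (neumannSpace g s Ω) ∧
    IsMinOn (fun w => (pairModular g s (starSet Ω) w + modular g Ω w) / modular g Ω w)
      (level g Ω μ (neumannSpace g s Ω)) u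

/-- The same for the regional Neumann problem. -/
def IsRegionalMinimizer {n : ℕ} (g : ℝ → ℝ) (s : ℝ) (Ω : Set (Rn n)) (μ : ℝ)
    (u : Rn n → ℝ) : Prop :=
  u ∈ level g Ω μ (regionalSpace g s Ω) ∧
    IsMinOn (fun w => (pairModular g s (Ω ×ˢ Ω) w + modular g Ω w) / modular g Ω w)
      (level g Ω μ (regionalSpace g s Ω)) u

/-- The same for the Robin problem with weight `β`. -/
def IsRobinMinimizer {n : ℕ} (g : ℝ → ℝ) (s : ℝ) (β : Rn n → ℝ) (Ω : Set (Rn n)) (μ : ℝ)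
    (u : Rn n → ℝ) : Prop :=
  u ∈ level g Ω μ (robinSpace g s β Ω) ∧
    IsMinOn (fun w => (pairModular g s (starSet Ω) w + modular g Ω w + weightedModular g β Ωᶜ w)
        / modular g Ω w)
      (level g Ω μ (robinSpace g s β Ω)) u

end

end FracOrlicz

open FracOrlicz

/-! Constants have zero Hölder quotient and lie in the Neumann and regional spaces because `Ω` is
bounded. For these two problems the constant at level `μ` is therefore a minimizer with eigenvalue
`1`, and the work is in the Dirichlet and Robin problems.

Both are instances of one problem: minimize `energy`, that is `Φ_S(u) + ∫ G(|u|) dm`, at fixed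
modular on `Ω`, where `m` lives on the complement of `Ω` and has the same null sets there as
Lebesgue measure. The Robin problem has `m = 2β dx`. The Dirichlet problem has `m = ∞ · dx`, so that
finite energy forces a function to vanish outside `Ω`.

A minimizer exists by the direct method (`exists_energy_minimizer`). On `Ω` compactness comes from a
local Poincaré inequality (`exists_measModular_sub_const_le`): on pieces of radius `r` a function is
close to constants, with total error at most a multiple of `r ^ s` times the energy, so bounded
energy gives total boundedness in modular (`exists_subseq_modular_cauchy`). Outside `Ω` there is no
compactness. There convexity is used instead: suitable convex combinations of the tails converge
a.e. (`exists_convexHull_ae_tendsto_exp`, `exists_ae_tendsto_of_exp`), and they are still minimizing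
because the energy is convex. Fatou's lemma bounds the energy of the limit. The Cauchy property on
`Ω` survives convex combinations, so the level is not lost (`le_measModular_of_approx`).

The Euler-Lagrange equation (`exists_multiplier_of_minimizer`) rests on the Δ₂ bound
`evenYoung_mul_le_rpow`, which makes modulars Gateaux differentiable, and on `lagrange_multiplier`,
where the constraint is restored by scaling down, an operation that never increases the energy. The
multiplier is nonnegative, hence the eigenvalues are positive. -/

namespace FracOrlicz

/-! ### The Young function: convexity, Δ₂ bound and Young-type inequalities -/

/-- A continuous Young density satisfying the growth condition. -/
structure IsRegularDensity (g : ℝ → ℝ) (pm pp : ℝ) : Prop where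
  density : IsYoungDensity g
  cont : ContinuousOn g (Ici 0)
  growth : GrowthCondition g pm pp

/-- The even extension `x ↦ G(|x|)` of the Young function. -/
noncomputable def evenYoung (g : ℝ → ℝ) (x : ℝ) : ℝ := young g |x|

lemma oddExt_zero (g : ℝ → ℝ) : oddExt g 0 = 0 := by simp [oddExt]

lemma oddExt_of_nonneg {g : ℝ → ℝ} (h0 : g 0 = 0) {x : ℝ} (hx : 0 ≤ x) : oddExt g x = g x := by
  rcases hx.eq_or_lt with rfl | hx
  · simp [oddExt, h0]
  · simp [oddExt, abs_of_pos hx, hx.ne']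

lemma oddExt_neg (g : ℝ → ℝ) (x : ℝ) : oddExt g (-x) = -oddExt g x := by
  simp [oddExt, neg_div]

lemma evenYoung_neg (g : ℝ → ℝ) (x : ℝ) : evenYoung g (-x) = evenYoung g x := by
  simp [evenYoung]

lemma evenYoung_abs (g : ℝ → ℝ) (x : ℝ) : evenYoung g |x| = evenYoung g x := by
  simp [evenYoung]

lemma evenYoung_zero (g : ℝ → ℝ) : evenYoung g 0 = 0 := by
  simp [evenYoung, young]

namespace IsRegularDensity

variable {g : ℝ → ℝ} {pm pp : ℝ}

lemma g_zero (h : IsRegularDensity g pm pp) : g 0 = 0 := h.density.zero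

lemma g_nonneg (h : IsRegularDensity g pm pp) {t : ℝ} (ht : 0 ≤ t) : 0 ≤ g t := by
  rcases ht.eq_or_lt with rfl | ht
  · exact h.g_zero.ge
  · exact (h.density.pos t ht).le

lemma monotone_oddExt (h : IsRegularDensity g pm pp) : Monotone (oddExt g) := by
  intro x y hxy
  have key : ∀ {a b : ℝ}, 0 ≤ a → a ≤ b → oddExt g a ≤ oddExt g b := fun {a b} ha hab => by
    rw [oddExt_of_nonneg h.g_zero ha, oddExt_of_nonneg h.g_zero (ha.trans hab)]
    exact h.density.mono ha (ha.trans hab) hab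
  have hnn : ∀ {a : ℝ}, 0 ≤ a → 0 ≤ oddExt g a := fun {a} ha => by
    rw [oddExt_of_nonneg h.g_zero ha]; exact h.g_nonneg ha
  rcases le_total 0 x with hx | hx
  · exact key hx hxy
  · rcases le_total 0 y with hy | hy
    · have := hnn (neg_nonneg.2 hx)
      rw [oddExt_neg] at this
      linarith [hnn hy]
    · have := key (neg_nonneg.2 hy) (neg_le_neg hxy)
      rw [oddExt_neg, oddExt_neg] at this
      linarith

/-- The sign factor jumps at the origin but is bounded by one, and `g |t|` tends to `g 0 = 0` there.
-/
lemma continuous_oddExt (h : IsRegularDensity g pm pp) : Continuous (oddExt g) := by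
  have h1 : Continuous fun x : ℝ => g |x| :=
    h.cont.comp_continuous continuous_abs fun x => abs_nonneg x
  rw [continuous_iff_continuousAt]
  intro x
  by_cases hx : x = 0
  · subst hx
    have h2 : Tendsto (fun x : ℝ => g |x|) (𝓝 0) (𝓝 0) := by
      simpa [h.g_zero] using h1.tendsto 0
    rw [ContinuousAt, oddExt_zero]
    refine squeeze_zero_norm (fun t => ?_) h2
    rw [oddExt, norm_mul, Real.norm_of_nonneg (h.g_nonneg (abs_nonneg t))]
    refine mul_le_of_le_one_right (h.g_nonneg (abs_nonneg t)) ?_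
    rw [norm_div, Real.norm_eq_abs, Real.norm_eq_abs, abs_abs]
    exact div_self_le_one _
  · exact h1.continuousAt.mul (continuousAt_id.div continuous_abs.continuousAt (by simpa using hx))

lemma evenYoung_eq (h : IsRegularDensity g pm pp) (x : ℝ) :
    evenYoung g x = ∫ τ in (0 : ℝ)..x, oddExt g τ := by
  have key : ∀ y : ℝ, 0 ≤ y → evenYoung g y = ∫ τ in (0 : ℝ)..y, oddExt g τ := fun y hy => by
    rw [evenYoung, abs_of_nonneg hy, young]
    refine intervalIntegral.integral_congr fun t ht => ?_
    rw [uIcc_of_le hy] at ht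
    exact (oddExt_of_nonneg h.g_zero ht.1).symm
  rcases le_total 0 x with hx | hx
  · exact key x hx
  · rw [← evenYoung_neg, key _ (neg_nonneg.2 hx)]
    have := intervalIntegral.integral_comp_neg (a := 0) (b := x) (oddExt g)
    simp only [oddExt_neg, intervalIntegral.integral_neg, neg_zero] at this
    rw [intervalIntegral.integral_symm, ← this, neg_neg]

lemma hasDerivAt_evenYoung (h : IsRegularDensity g pm pp) (x : ℝ) :
    HasDerivAt (evenYoung g) (oddExt g x) x := by
  rw [show evenYoung g = fun x => ∫ τ in (0 : ℝ)..x, oddExt g τ from funext h.evenYoung_eq]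
  exact intervalIntegral.integral_hasDerivAt_right (h.continuous_oddExt.intervalIntegrable _ _)
    (h.continuous_oddExt.stronglyMeasurableAtFilter _ _) h.continuous_oddExt.continuousAt

lemma continuous_evenYoung (h : IsRegularDensity g pm pp) : Continuous (evenYoung g) :=
  continuous_iff_continuousAt.2 fun x => (h.hasDerivAt_evenYoung x).continuousAt

lemma convexOn_evenYoung (h : IsRegularDensity g pm pp) : ConvexOn ℝ univ (evenYoung g) := by
  refine Monotone.convexOn_univ_of_deriv (fun x => (h.hasDerivAt_evenYoung x).differentiableAt) ?_
  rw [show deriv (evenYoung g) = oddExt g from funext fun x => (h.hasDerivAt_evenYoung x).deriv]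
  exact h.monotone_oddExt

lemma evenYoung_le_of_abs_le (h : IsRegularDensity g pm pp) {x y : ℝ} (hxy : |x| ≤ |y|) :
    evenYoung g x ≤ evenYoung g y := by
  rw [← evenYoung_abs g x, ← evenYoung_abs g y]
  refine monotoneOn_of_deriv_nonneg (convex_Ici 0) h.continuous_evenYoung.continuousOn
    (fun x _ => (h.hasDerivAt_evenYoung x).differentiableAt.differentiableWithinAt)
    (fun t ht => ?_) (abs_nonneg x) (abs_nonneg y) hxy
  rw [interior_Ici] at ht
  rw [(h.hasDerivAt_evenYoung t).deriv, oddExt_of_nonneg h.g_zero ht.le]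
  exact h.g_nonneg ht.le

lemma evenYoung_nonneg (h : IsRegularDensity g pm pp) (x : ℝ) : 0 ≤ evenYoung g x := by
  rw [← evenYoung_zero g]
  exact h.evenYoung_le_of_abs_le (by simp)

lemma evenYoung_pos (h : IsRegularDensity g pm pp) {x : ℝ} (hx : x ≠ 0) : 0 < evenYoung g x := by
  rw [← evenYoung_abs g x]
  have hx' := abs_pos.2 hx
  have : StrictMonoOn (evenYoung g) (Ici 0) := by
    refine strictMonoOn_of_deriv_pos (convex_Ici 0) h.continuous_evenYoung.continuousOn
      (fun t ht => ?_)
    rw [interior_Ici] at ht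
    rw [(h.hasDerivAt_evenYoung t).deriv, oddExt_of_nonneg h.g_zero (le_of_lt ht)]
    exact h.density.pos t ht
  simpa [evenYoung_zero] using this (mem_Ici.2 le_rfl) hx'.le hx'

lemma mul_oddExt (_h : IsRegularDensity g pm pp) (x : ℝ) : x * oddExt g x = |x| * g |x| := by
  rcases eq_or_ne x 0 with rfl | hx
  · simp
  · rw [oddExt]
    field_simp
    rw [sq_abs, mul_comm]

lemma abs_oddExt (h : IsRegularDensity g pm pp) (x : ℝ) : |oddExt g x| = g |x| := by
  rcases eq_or_ne x 0 with rfl | hx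
  · simp [oddExt_zero, h.g_zero]
  · rw [oddExt, abs_mul, abs_div, abs_abs, div_self (abs_ne_zero.2 hx), mul_one,
      abs_of_nonneg (h.g_nonneg (abs_nonneg x))]

lemma mul_oddExt_le (h : IsRegularDensity g pm pp) (x : ℝ) :
    x * oddExt g x ≤ pp * evenYoung g x := by
  rcases eq_or_ne x 0 with rfl | hx
  · simp [evenYoung_zero]
  · rw [h.mul_oddExt]
    exact (div_le_iff₀ (h.evenYoung_pos hx)).1 (h.growth.upper |x| (abs_pos.2 hx))

lemma le_mul_oddExt (h : IsRegularDensity g pm pp) (x : ℝ) :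
    evenYoung g x ≤ x * oddExt g x := by
  rcases eq_or_ne x 0 with rfl | hx
  · simp [evenYoung_zero]
  · rw [h.mul_oddExt]
    have := (le_div_iff₀ (h.evenYoung_pos hx)).1 (h.growth.lower |x| (abs_pos.2 hx))
    refine le_trans ?_ this
    exact le_mul_of_one_le_left (h.evenYoung_nonneg x) h.growth.one_lt.le

lemma one_lt_pp (h : IsRegularDensity g pm pp) : 1 < pp :=
  h.growth.one_lt.trans_le ((h.growth.lower 1 one_pos).trans (h.growth.upper 1 one_pos))

lemma evenYoung_mul_le (h : IsRegularDensity g pm pp) {c : ℝ} (hc0 : 0 ≤ c) (hc1 : c ≤ 1) (x : ℝ) :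
    evenYoung g (c * x) ≤ c * evenYoung g x := by
  have := h.convexOn_evenYoung.2 (mem_univ x) (mem_univ 0) hc0 (sub_nonneg.2 hc1) (by ring)
  simpa [evenYoung_zero] using this

lemma le_evenYoung_mul (h : IsRegularDensity g pm pp) {c : ℝ} (hc1 : 1 ≤ c) (x : ℝ) :
    c * evenYoung g x ≤ evenYoung g (c * x) := by
  have hc : 0 < c := by linarith
  have := h.evenYoung_mul_le (inv_nonneg.2 hc.le) (inv_le_one_of_one_le₀ hc1) (c * x)
  rw [inv_mul_cancel_left₀ hc.ne'] at this
  rwa [← div_eq_inv_mul, le_div_iff₀ hc, mul_comm] at this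

/-- The upper growth bound says that `a ↦ G(a) a ^ (-pp)` has nonpositive derivative on the positive
axis; compare its values at `|x|` and `c |x|`. This is the Δ₂ condition in quantitative form. -/
lemma evenYoung_mul_le_rpow (h : IsRegularDensity g pm pp) {c : ℝ} (hc : 1 ≤ c) (x : ℝ) :
    evenYoung g (c * x) ≤ c ^ pp * evenYoung g x := by
  have hc0 : 0 < c := by linarith
  rw [← evenYoung_abs g x, ← evenYoung_abs g (c * x), abs_mul, abs_of_pos hc0]
  rcases (abs_nonneg x).eq_or_lt with hx | hx
  · simp [← hx, evenYoung_zero]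
  set t := |x|
  have hd : ∀ a : ℝ, 0 < a → HasDerivAt (fun a => evenYoung g a * a ^ (-pp))
      (oddExt g a * a ^ (-pp) + evenYoung g a * (-pp * a ^ (-pp - 1))) a := fun a ha =>
    (h.hasDerivAt_evenYoung a).mul (Real.hasDerivAt_rpow_const (Or.inl ha.ne'))
  have hanti : AntitoneOn (fun a => evenYoung g a * a ^ (-pp)) (Ioi 0) := by
    refine antitoneOn_of_deriv_nonpos (convex_Ioi 0)
      (fun a ha => (hd a ha).continuousAt.continuousWithinAt)
      (fun a ha => (hd a (by simpa using ha)).differentiableAt.differentiableWithinAt)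
      (fun a ha => ?_)
    rw [interior_Ioi] at ha
    have ha' : (0 : ℝ) < a := ha
    rw [(hd a ha).deriv, show -pp = (-pp - 1) + 1 by ring, Real.rpow_add ha', Real.rpow_one]
    have := h.mul_oddExt_le a
    have h3 : 0 ≤ a ^ (-pp - 1) := Real.rpow_nonneg ha'.le _
    rw [show (-pp - 1 + 1 - 1 : ℝ) = -pp - 1 by ring]
    nlinarith
  have := hanti (mem_Ioi.2 hx) (mem_Ioi.2 (mul_pos hc0 hx)) (le_mul_of_one_le_left hx.le hc)
  simp only [Real.rpow_neg (mul_pos hc0 hx).le, Real.rpow_neg hx.le,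
    Real.mul_rpow hc0.le hx.le] at this
  have hp := Real.rpow_pos_of_pos hx pp
  have hq := Real.rpow_pos_of_pos hc0 pp
  rw [← div_eq_mul_inv, ← div_eq_mul_inv, div_le_div_iff₀ (by positivity) hp] at this
  nlinarith

/-- Midpoint convexity between `2x` and `2y`, followed by Δ₂. It serves as a quasi-triangle
inequality for modulars. -/
lemma evenYoung_add_le (h : IsRegularDensity g pm pp) (x y : ℝ) :
    evenYoung g (x + y) ≤ 2 ^ pp * (evenYoung g x + evenYoung g y) := by
  have h1 := h.convexOn_evenYoung.2 (mem_univ (2 * x)) (mem_univ (2 * y))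
    (by norm_num : (0 : ℝ) ≤ 1 / 2) (by norm_num : (0 : ℝ) ≤ 1 / 2) (by norm_num)
  have h2 := h.evenYoung_mul_le_rpow one_le_two x
  have h3 := h.evenYoung_mul_le_rpow one_le_two y
  simp only [smul_eq_mul] at h1
  rw [show 1 / 2 * (2 * x) + 1 / 2 * (2 * y) = x + y by ring] at h1
  have h4 : 0 ≤ (2 : ℝ) ^ pp * (evenYoung g x + evenYoung g y) :=
    mul_nonneg (by positivity) (add_nonneg (h.evenYoung_nonneg x) (h.evenYoung_nonneg y))
  linarith

/-- A Young inequality without the conjugate function: with `T = |x| + |y|`, both factors are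
controlled by `T`, and `T g(T) ≤ pp G(T)`. -/
lemma abs_oddExt_mul_le (h : IsRegularDensity g pm pp) (x y : ℝ) :
    |oddExt g x * y| ≤ pp * 2 ^ pp * (evenYoung g x + evenYoung g y) := by
  rw [abs_mul, h.abs_oddExt]
  have h0 : 0 ≤ |x| + |y| := by positivity
  have h1 : g |x| ≤ oddExt g (|x| + |y|) := by
    rw [oddExt_of_nonneg h.g_zero h0]
    exact h.density.mono (abs_nonneg x) h0 (le_add_of_nonneg_right (abs_nonneg y))
  have h2 := h.mul_oddExt_le (|x| + |y|)
  have h3 := h.evenYoung_add_le |x| |y|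
  rw [evenYoung_abs, evenYoung_abs] at h3
  have h4 := h.one_lt_pp
  have h5 : 0 ≤ g |x| := h.g_nonneg (abs_nonneg x)
  calc g |x| * |y| ≤ (|x| + |y|) * oddExt g (|x| + |y|) := by
        rw [mul_comm]
        exact mul_le_mul (le_add_of_nonneg_left (abs_nonneg x)) h1 h5 h0
    _ ≤ pp * (2 ^ pp * (evenYoung g x + evenYoung g y)) :=
        h2.trans (mul_le_mul_of_nonneg_left h3 (by linarith))
    _ = _ := by ring

lemma tendsto_evenYoung (h : IsRegularDensity g pm pp) : Tendsto (evenYoung g) atTop atTop := by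
  have h1 := h.evenYoung_pos one_ne_zero
  refine tendsto_atTop_mono' _ ?_ (tendsto_id.atTop_mul_const h1)
  filter_upwards [eventually_ge_atTop 1] with t ht
  simpa using h.le_evenYoung_mul ht 1

end IsRegularDensity

/-! ### Modulars over an arbitrary measure -/

/-- The modular `∫ G(|f|) dm` with respect to an arbitrary measure. -/
noncomputable def measModular {α : Type*} [MeasurableSpace α] (g : ℝ → ℝ) (m : Measure α)
    (f : α → ℝ) : ℝ≥0∞ :=
  ∫⁻ a, ENNReal.ofReal (evenYoung g (f a)) ∂m

section Modular

variable {g : ℝ → ℝ} {pm pp : ℝ} {α : Type*} [MeasurableSpace α] {m : Measure α}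

lemma measModular_abs (f : α → ℝ) : measModular g m (fun a => |f a|) = measModular g m f := by
  simp [measModular, evenYoung_abs]

lemma measModular_zero : measModular g m (0 : α → ℝ) = 0 := by
  simp [measModular, evenYoung_zero]

lemma measModular_congr {f h : α → ℝ} (hfh : f =ᵐ[m] h) :
    measModular g m f = measModular g m h := by
  refine lintegral_congr_ae ?_
  filter_upwards [hfh] with a ha
  rw [ha]

namespace IsRegularDensity

lemma aemeasurable_ofReal (h : IsRegularDensity g pm pp) {f : α → ℝ} (hf : AEMeasurable f m) :
    AEMeasurable (fun a => ENNReal.ofReal (evenYoung g (f a))) m :=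
  (h.continuous_evenYoung.measurable.comp_aemeasurable hf).ennreal_ofReal

lemma measModular_mono (h : IsRegularDensity g pm pp) {f k : α → ℝ}
    (hfk : ∀ a, |f a| ≤ |k a|) : measModular g m f ≤ measModular g m k :=
  lintegral_mono fun a => ENNReal.ofReal_le_ofReal (h.evenYoung_le_of_abs_le (hfk a))

lemma measModular_smul_le_self (h : IsRegularDensity g pm pp) {c : ℝ} (hc0 : 0 ≤ c) (hc1 : c ≤ 1)
    (f : α → ℝ) : measModular g m (c • f) ≤ measModular g m f := by
  refine h.measModular_mono fun a => ?_
  rw [Pi.smul_apply, smul_eq_mul, abs_mul, abs_of_nonneg hc0]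
  exact mul_le_of_le_one_left (abs_nonneg _) hc1

lemma le_measModular_smul (h : IsRegularDensity g pm pp) {c : ℝ} (hc : 1 ≤ c)
    (f : α → ℝ) : ENNReal.ofReal c * measModular g m f ≤ measModular g m (c • f) := by
  rw [measModular, measModular, ← lintegral_const_mul' _ _ ENNReal.ofReal_ne_top]
  refine lintegral_mono fun a => ?_
  rw [← ENNReal.ofReal_mul (by linarith)]
  exact ENNReal.ofReal_le_ofReal (h.le_evenYoung_mul hc (f a))

lemma measModular_smul_le_rpow (h : IsRegularDensity g pm pp) {c : ℝ} (hc : 1 ≤ c)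
    (f : α → ℝ) : measModular g m (c • f) ≤ ENNReal.ofReal (c ^ pp) * measModular g m f := by
  rw [measModular, measModular, ← lintegral_const_mul' _ _ ENNReal.ofReal_ne_top]
  refine lintegral_mono fun a => ?_
  rw [← ENNReal.ofReal_mul (by positivity)]
  exact ENNReal.ofReal_le_ofReal (h.evenYoung_mul_le_rpow hc (f a))

lemma measModular_smul_lt_top (h : IsRegularDensity g pm pp) (c : ℝ) {f : α → ℝ}
    (hf : measModular g m f < ∞) : measModular g m (c • f) < ∞ := by
  have h1 : measModular g m (c • f) ≤ measModular g m ((1 + |c|) • f) := by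
    refine h.measModular_mono fun a => ?_
    rw [Pi.smul_apply, Pi.smul_apply, smul_eq_mul, smul_eq_mul, abs_mul, abs_mul]
    refine mul_le_mul_of_nonneg_right ?_ (abs_nonneg _)
    rw [abs_of_nonneg (a := 1 + |c|) (by positivity)]
    linarith
  refine (h1.trans (h.measModular_smul_le_rpow (by linarith [abs_nonneg c]) f)).trans_lt ?_
  exact ENNReal.mul_lt_top ENNReal.ofReal_lt_top hf

lemma measModular_add_le (h : IsRegularDensity g pm pp) {f k : α → ℝ} (hf : AEMeasurable f m) :
    measModular g m (f + k) ≤ ENNReal.ofReal (2 ^ pp) * (measModular g m f + measModular g m k) := by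
  rw [measModular, measModular, measModular, ← lintegral_add_left' (h.aemeasurable_ofReal hf),
    ← lintegral_const_mul' _ _ ENNReal.ofReal_ne_top]
  refine lintegral_mono fun a => ?_
  rw [← ENNReal.ofReal_add (h.evenYoung_nonneg _) (h.evenYoung_nonneg _),
    ← ENNReal.ofReal_mul (by positivity)]
  exact ENNReal.ofReal_le_ofReal (h.evenYoung_add_le _ _)

lemma measModular_add_lt_top (h : IsRegularDensity g pm pp) {f k : α → ℝ} (hf : AEMeasurable f m)
    (hf' : measModular g m f < ∞) (hk : measModular g m k < ∞) :
    measModular g m (f + k) < ∞ :=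
  (h.measModular_add_le hf).trans_lt
    (ENNReal.mul_lt_top ENNReal.ofReal_lt_top (ENNReal.add_lt_top.2 ⟨hf', hk⟩))

lemma measModular_convex_le (h : IsRegularDensity g pm pp) {f k : α → ℝ} (hf : AEMeasurable f m)
    {a b : ℝ} (ha : 0 ≤ a) (hb : 0 ≤ b) (hab : a + b = 1) :
    measModular g m (a • f + b • k) ≤
      ENNReal.ofReal a * measModular g m f + ENNReal.ofReal b * measModular g m k := by
  rw [measModular, measModular, measModular, ← lintegral_const_mul' _ _ ENNReal.ofReal_ne_top,
    ← lintegral_const_mul' _ _ ENNReal.ofReal_ne_top,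
    ← lintegral_add_left' ((h.aemeasurable_ofReal hf).const_mul _)]
  refine lintegral_mono fun x => ?_
  rw [← ENNReal.ofReal_mul ha, ← ENNReal.ofReal_mul hb,
    ← ENNReal.ofReal_add (mul_nonneg ha (h.evenYoung_nonneg _))
      (mul_nonneg hb (h.evenYoung_nonneg _))]
  exact ENNReal.ofReal_le_ofReal (h.convexOn_evenYoung.2 (mem_univ _) (mem_univ _) ha hb hab)

lemma measModular_le_liminf (h : IsRegularDensity g pm pp) {f : ℕ → α → ℝ} {u : α → ℝ}
    (hf : ∀ k, AEMeasurable (f k) m)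
    (hu : ∀ᵐ a ∂m, Tendsto (fun k => f k a) atTop (𝓝 (u a))) :
    measModular g m u ≤ liminf (fun k => measModular g m (f k)) atTop := by
  refine le_trans (lintegral_mono_ae ?_) (lintegral_liminf_le' fun k => h.aemeasurable_ofReal (hf k))
  filter_upwards [hu] with a ha
  have : Tendsto (fun k => ENNReal.ofReal (evenYoung g (f k a))) atTop
      (𝓝 (ENNReal.ofReal (evenYoung g (u a)))) :=
    (ENNReal.continuous_ofReal.comp h.continuous_evenYoung).tendsto _ |>.comp ha
  exact this.liminf_eq.ge

lemma measModular_le_of_tendsto (h : IsRegularDensity g pm pp) {f : ℕ → α → ℝ} {u : α → ℝ}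
    (hf : ∀ k, AEMeasurable (f k) m)
    (hu : ∀ᵐ a ∂m, Tendsto (fun k => f k a) atTop (𝓝 (u a))) {c : ℝ≥0∞}
    (hc : ∀ᶠ k in atTop, measModular g m (f k) ≤ c) : measModular g m u ≤ c := by
  refine (h.measModular_le_liminf hf hu).trans ?_
  exact liminf_le_of_le (by isBoundedDefault) fun b hb => by
    obtain ⟨k, hk1, hk2⟩ := (hb.and hc).exists
    exact hk1.trans hk2

lemma integrable_evenYoung (h : IsRegularDensity g pm pp) {f : α → ℝ} (hf : AEMeasurable f m)
    (hf' : measModular g m f < ∞) : Integrable (fun a => evenYoung g (f a)) m := by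
  refine ⟨(h.continuous_evenYoung.measurable.comp_aemeasurable hf).aestronglyMeasurable, ?_⟩
  rw [hasFiniteIntegral_iff_ofReal (Eventually.of_forall fun a => h.evenYoung_nonneg _)]
  exact hf'

lemma toReal_measModular (h : IsRegularDensity g pm pp) {f : α → ℝ} (hf : AEMeasurable f m) :
    (measModular g m f).toReal = ∫ a, evenYoung g (f a) ∂m := by
  rw [integral_eq_lintegral_of_nonneg_ae (Eventually.of_forall fun a => h.evenYoung_nonneg _)
    (h.continuous_evenYoung.measurable.comp_aemeasurable hf).aestronglyMeasurable]
  rfl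

lemma integrable_oddExt_mul (h : IsRegularDensity g pm pp) {f k : α → ℝ} (hf : AEMeasurable f m)
    (hk : AEMeasurable k m) (hf' : measModular g m f < ∞) (hk' : measModular g m k < ∞) :
    Integrable (fun a => oddExt g (f a) * k a) m := by
  refine Integrable.mono' (((h.integrable_evenYoung hf hf').add
    (h.integrable_evenYoung hk hk')).const_mul (pp * 2 ^ pp)) ?_ ?_
  · exact ((h.continuous_oddExt.measurable.comp_aemeasurable hf).mul hk).aestronglyMeasurable
  · exact Eventually.of_forall fun a => h.abs_oddExt_mul_le _ _

/-- Differentiation under the integral sign. For `|t| < 1` the Young-type inequality dominates the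
differentiated integrand by a multiple of `G(|f| + |k|) + G(k)`, which is integrable by Δ₂. -/
lemma hasDerivAt_measModular (h : IsRegularDensity g pm pp) {f k : α → ℝ} (hf : AEMeasurable f m)
    (hk : AEMeasurable k m) (hf' : measModular g m f < ∞) (hk' : measModular g m k < ∞) :
    HasDerivAt (fun t : ℝ => (measModular g m (f + t • k)).toReal)
      (∫ a, oddExt g (f a) * k a ∂m) 0 := by
  have hmeas : ∀ t : ℝ, AEMeasurable (f + t • k) m := fun t => hf.add (hk.const_smul t)
  have e : (fun t : ℝ => (measModular g m (f + t • k)).toReal) =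
      fun t => ∫ a, evenYoung g (f a + t * k a) ∂m := funext fun t => h.toReal_measModular (hmeas t)
  have habs : AEMeasurable (fun a => |f a| + |k a|) m :=
    (continuous_abs.measurable.comp_aemeasurable hf).add
      (continuous_abs.measurable.comp_aemeasurable hk)
  have habs' : measModular g m (fun a => |f a| + |k a|) < ∞ :=
    h.measModular_add_lt_top (f := fun a => |f a|) (k := fun a => |k a|)
      (continuous_abs.measurable.comp_aemeasurable hf) (by rwa [measModular_abs])
      (by rwa [measModular_abs])
  have key := hasDerivAt_integral_of_dominated_loc_of_deriv_le (μ := m) (x₀ := (0 : ℝ))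
    (F := fun t a => evenYoung g (f a + t * k a))
    (F' := fun t a => oddExt g (f a + t * k a) * k a)
    (bound := fun a => pp * 2 ^ pp * (evenYoung g (|f a| + |k a|) + evenYoung g (k a)))
    (Metric.ball_mem_nhds 0 one_pos)
    (Eventually.of_forall fun t =>
      (h.continuous_evenYoung.measurable.comp_aemeasurable (hmeas t)).aestronglyMeasurable)
    (by simpa using h.integrable_evenYoung hf hf')
    ((h.continuous_oddExt.measurable.comp_aemeasurable (hmeas 0)).mul hk).aestronglyMeasurable
    (Eventually.of_forall fun a t ht => ?_)
    (((h.integrable_evenYoung habs habs').add (h.integrable_evenYoung hk hk')).const_mul _)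
    (Eventually.of_forall fun a t _ => ?_)
  · rw [e]
    simpa using key.2
  · refine (h.abs_oddExt_mul_le _ _).trans ?_
    have hpp := h.one_lt_pp
    refine mul_le_mul_of_nonneg_left ?_ (by positivity)
    gcongr
    refine h.evenYoung_le_of_abs_le ?_
    rw [abs_of_nonneg (a := |f a| + |k a|) (by positivity)]
    refine (abs_add_le _ _).trans (add_le_add_right ?_ _)
    rw [abs_mul]
    refine mul_le_of_le_one_left (abs_nonneg _) ?_
    simpa using (mem_ball_zero_iff.1 ht).le
  · have h1 : HasDerivAt (fun t : ℝ => f a + t * k a) (k a) t := by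
      simpa using ((hasDerivAt_id t).mul_const (k a)).const_add (f a)
    exact (h.hasDerivAt_evenYoung _).comp t h1

/-- Near `c`, the ray through `f` is the line through `c • f` in direction `f`, so differentiability
at parameter zero applies after a shift. -/
lemma continuous_measModular_smul (h : IsRegularDensity g pm pp) {f : α → ℝ}
    (hf : AEMeasurable f m) (hf' : measModular g m f < ∞) :
    Continuous fun c : ℝ => (measModular g m (c • f)).toReal := by
  rw [continuous_iff_continuousAt]
  intro c
  have h1 := (h.hasDerivAt_measModular (hf.const_smul c) hf (h.measModular_smul_lt_top c hf')
    hf').continuousAt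
  have h2 : Tendsto (fun t : ℝ => t - c) (𝓝 c) (𝓝 0) := by
    simpa using (continuous_sub_right c).tendsto c
  have h3 := h1.tendsto.comp h2
  simpa [Function.comp_def, ← add_smul, ContinuousAt] using h3

lemma exists_smul_measModular_eq (h : IsRegularDensity g pm pp) {f : α → ℝ}
    (hf : AEMeasurable f m) (hf' : measModular g m f < ∞) {μ : ℝ} (hμ0 : 0 ≤ μ)
    (hμ : ENNReal.ofReal μ ≤ measModular g m f) :
    ∃ c ∈ Icc (0 : ℝ) 1, measModular g m (c • f) = ENNReal.ofReal μ := by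
  have hc := (h.continuous_measModular_smul hf hf').continuousOn (s := Icc (0 : ℝ) 1)
  obtain ⟨c, hc1, hc2⟩ := intermediate_value_Icc zero_le_one hc (show μ ∈ Icc _ _ from by
    constructor
    · simpa [measModular_zero] using hμ0
    · rw [one_smul]
      exact (ENNReal.ofReal_le_iff_le_toReal hf'.ne).1 hμ)
  refine ⟨c, hc1, ?_⟩
  rw [← hc2]
  exact (ENNReal.ofReal_toReal (h.measModular_smul_lt_top c hf').ne).symm

/-- Integrates `G(t) ≤ t g(t)`. It makes the derivative of the constraint at `u` in direction `u`
strictly positive, and later gives the sign of the multiplier. -/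
lemma toReal_measModular_le_integral (h : IsRegularDensity g pm pp) {f : α → ℝ}
    (hf : AEMeasurable f m) (hf' : measModular g m f < ∞) :
    (measModular g m f).toReal ≤ ∫ a, oddExt g (f a) * f a ∂m := by
  rw [h.toReal_measModular hf]
  refine integral_mono (h.integrable_evenYoung hf hf') (h.integrable_oddExt_mul hf hf hf' hf')
    fun a => ?_
  rw [mul_comm]
  exact h.le_mul_oddExt _

end IsRegularDensity

end Modular

/-! ### An abstract Lagrange multiplier rule -/

/-- Lagrange multipliers for a minimization problem on a level set of `I`, when both functionals
are Gateaux differentiable and points above the level can be scaled down to it without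
increasing `F`. -/
lemma lagrange_multiplier {E : Type*} [AddCommGroup E] [Module ℝ E] {X : Submodule ℝ E}
    {F I A B : E → ℝ} {u : E} (hu : u ∈ X)
    (hF : ∀ v ∈ X, HasDerivAt (fun t : ℝ => F (u + t • v)) (A v) 0)
    (hI : ∀ v ∈ X, HasDerivAt (fun t : ℝ => I (u + t • v)) (B v) 0)
    (hA : ∀ v ∈ X, ∀ a b : ℝ, A (a • v + b • u) = a * A v + b * A u)
    (hB : ∀ v ∈ X, ∀ a b : ℝ, B (a • v + b • u) = a * B v + b * B u)
    (hscale : ∀ z ∈ X, I u ≤ I z → ∃ c : ℝ, I (c • z) = I u ∧ F (c • z) ≤ F z)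
    (hmin : ∀ z ∈ X, I z = I u → F u ≤ F z) (hBu : 0 < B u) :
    ∀ v ∈ X, A v = A u / B u * B v := by
  -- A direction that raises `I` to first order cannot lower `F`: otherwise a short step along it,
  -- scaled back to the level of `u`, would beat the minimizer.
  have key : ∀ d ∈ X, 0 < B d → 0 ≤ A d := by
    intro d hd hBd
    by_contra! hAd
    have h1 := (hF d hd).tendsto_slope_zero_right.eventually (gt_mem_nhds hAd)
    have h2 := (hI d hd).tendsto_slope_zero_right.eventually (lt_mem_nhds hBd)
    obtain ⟨t, ⟨ht1, ht2⟩, ht⟩ := ((h1.and h2).and self_mem_nhdsWithin).exists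
    have ht0 : 0 < t⁻¹ := inv_pos.2 ht
    simp only [zero_add, zero_smul, add_zero, smul_eq_mul] at ht1 ht2
    have h3 : F (u + t • d) < F u := by
      by_contra! hc
      exact absurd ht1 (not_lt.2 (mul_nonneg ht0.le (sub_nonneg.2 hc)))
    have h4 : I u ≤ I (u + t • d) := by
      by_contra! hc
      exact absurd ht2 (not_lt.2 (mul_nonpos_of_nonneg_of_nonpos ht0.le (sub_nonpos.2 hc.le)))
    have hz : u + t • d ∈ X := X.add_mem hu (X.smul_mem t hd)
    obtain ⟨c, hc1, hc2⟩ := hscale _ hz h4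
    linarith [hmin _ (X.smul_mem c hz) hc1]
  -- Tangent directions are tilted by `η • u`, which makes `I` strictly increase since `B u > 0`.
  -- The choice of `η` keeps `η * A u` below half of `-w`, so a negative `w` stays negative.
  have key2 : ∀ v ∈ X, ∀ a b : ℝ, a * B v + b * B u = 0 → 0 ≤ a * A v + b * A u := by
    intro v hv a b hab
    by_contra! hneg
    set w := a * A v + b * A u
    have hη : 0 < -w / (2 * (|A u| + 1)) := by
      have : 0 < -w := by linarith
      positivity
    set η := -w / (2 * (|A u| + 1)) with hηd
    have h1 := key (a • v + (b + η) • u) (X.add_mem (X.smul_mem _ hv) (X.smul_mem _ hu))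
      (by rw [hB v hv]; nlinarith)
    rw [hA v hv] at h1
    have h2 : η * A u ≤ -w / 2 := by
      have h3 : η * (|A u| + 1) = -w / 2 := by rw [hηd]; field_simp
      nlinarith [le_abs_self (A u)]
    have h4 : a * A v + (b + η) * A u = w + η * A u := by simp only [w]; ring
    linarith
  intro v hv
  -- The tangent direction `B u • v - B v • u` and its opposite together turn the inequality into an
  -- equality.
  have h1 := key2 v hv (B u) (-B v) (by ring)
  have h2 := key2 v hv (-B u) (B v) (by ring)
  field_simp
  linarith

/-! ### Almost everywhere convergence of convex combinations -/

/-- From a sequence of nonnegative functions one can pick convex combinations of the tails that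
converge almost everywhere in `[0, ∞]`. -/
lemma exists_convexHull_ae_tendsto_exp {α : Type*} [MeasurableSpace α] {P : Measure α}
    [IsFiniteMeasure P] {u : ℕ → α → ℝ} (hu : ∀ k, AEMeasurable (u k) P)
    (h0 : ∀ k a, 0 ≤ u k a) :
    ∃ f : ℕ → α → ℝ, (∀ k, f k ∈ convexHull ℝ (u '' Ici k)) ∧
      ∀ᵐ a ∂P, ∃ l : ℝ, Tendsto (fun k => Real.exp (-(f k a) / 2)) atTop (𝓝 l) := by
  set C : ℕ → Set (α → ℝ) := fun k => convexHull ℝ (u '' Ici k) with hC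
  have hCanti : ∀ {j k}, j ≤ k → C k ⊆ C j := fun {j k} hjk =>
    convexHull_mono (image_mono (Ici_subset_Ici.2 hjk))
  have hCprop : ∀ k, ∀ f ∈ C k, AEMeasurable f P ∧ ∀ a, 0 ≤ f a := by
    intro k f hf
    have hconv : Convex ℝ {f : α → ℝ | AEMeasurable f P ∧ ∀ a, 0 ≤ f a} := by
      intro f hf g hg a b ha hb _
      exact ⟨(hf.1.const_smul a).add (hg.1.const_smul b), fun x =>
        add_nonneg (mul_nonneg ha (hf.2 x)) (mul_nonneg hb (hg.2 x))⟩
    refine convexHull_min ?_ hconv hf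
    rintro _ ⟨j, _, rfl⟩
    exact ⟨hu j, h0 j⟩
  have hCne : ∀ k, (C k).Nonempty := fun k => ⟨u k, subset_convexHull _ _ ⟨k, self_mem_Ici, rfl⟩⟩
  -- The functional `J` is strictly convex and bounded below, so near-minimizers of it over the
  -- shrinking convex hulls of the tails must come close to each other.
  set J : (α → ℝ) → ℝ := fun f => ∫ a, Real.exp (-(f a)) ∂P with hJ
  have hint : ∀ {f : α → ℝ}, AEMeasurable f P → (∀ a, 0 ≤ f a) →
      Integrable (fun a => Real.exp (-(f a))) P := fun {f} hf hf0 => by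
    refine Integrable.of_bound (C := 1) (Real.measurable_exp.comp_aemeasurable hf.neg).aestronglyMeasurable
      (Eventually.of_forall fun a => ?_)
    rw [Real.norm_of_nonneg (Real.exp_pos _).le, Real.exp_le_one_iff]
    linarith [hf0 a]
  have hJ0 : ∀ f, 0 ≤ J f := fun f => integral_nonneg fun a => (Real.exp_pos _).le
  have hJbdd : ∀ k, BddBelow (J '' C k) := fun k => ⟨0, by rintro _ ⟨f, _, rfl⟩; exact hJ0 f⟩
  set i : ℕ → ℝ := fun k => sInf (J '' C k) with hi
  have himono : Monotone i := fun j k hjk =>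
    csInf_le_csInf (hJbdd j) ((hCne k).image J) (image_mono (hCanti hjk))
  have hibdd : BddAbove (range i) := by
    refine ⟨∫ _, 1 ∂P, ?_⟩
    rintro _ ⟨k, rfl⟩
    obtain ⟨f, hf⟩ := hCne k
    refine (csInf_le (hJbdd k) ⟨f, hf, rfl⟩).trans ?_
    refine integral_mono (hint (hCprop k f hf).1 (hCprop k f hf).2) (integrable_const _) fun a => ?_
    rw [Real.exp_le_one_iff]
    linarith [(hCprop k f hf).2 a]
  set L := ⨆ k, i k
  have hilim : Tendsto i atTop (𝓝 L) := tendsto_atTop_ciSup himono hibdd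
  have hiL : ∀ k, i k ≤ L := fun k => le_ciSup hibdd k
  have hex : ∀ k : ℕ, ∃ f ∈ C k, J f < i k + 1 / ((k : ℝ) + 1) := by
    intro k
    obtain ⟨_, ⟨f, hf, rfl⟩, hlt⟩ := exists_lt_of_csInf_lt ((hCne k).image J)
      (show sInf (J '' C k) < i k + 1 / ((k : ℝ) + 1) from lt_add_of_pos_right _ (by positivity))
    exact ⟨f, hf, hlt⟩
  choose f hfC hfJ using hex
  have hgap : ∀ N j k, N ≤ j → N ≤ k →
      ∫ a, (Real.exp (-(f j a) / 2) - Real.exp (-(f k a) / 2)) ^ 2 ∂P ≤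
        2 * (L - i N + 1 / ((N : ℝ) + 1)) := by
    intro N j k hj hk
    have mj := hCprop j _ (hfC j)
    have mk := hCprop k _ (hfC k)
    set z : α → ℝ := (1 / 2 : ℝ) • f j + (1 / 2 : ℝ) • f k
    have hz : z ∈ C N := (convex_convexHull ℝ _) (hCanti hj (hfC j)) (hCanti hk (hfC k))
      (by norm_num) (by norm_num) (by norm_num)
    have mz := hCprop N z hz
    -- A parallelogram-type identity: with `z` the midpoint, the square is exactly the convexity
    -- defect of `exp (-·)`. Its integral is small since `J (f j)` and `J (f k)` are almost minimal
    -- while `J z` is at least `i N`.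
    have e : ∀ a, (Real.exp (-(f j a) / 2) - Real.exp (-(f k a) / 2)) ^ 2 =
        Real.exp (-(f j a)) + Real.exp (-(f k a)) - 2 * Real.exp (-(z a)) := by
      intro a
      have e1 : -(f j a) = -(f j a) / 2 + -(f j a) / 2 := by ring
      have e2 : -(f k a) = -(f k a) / 2 + -(f k a) / 2 := by ring
      have e3 : -(z a) = -(f j a) / 2 + -(f k a) / 2 := by
        simp only [z, Pi.add_apply, Pi.smul_apply, smul_eq_mul]; ring
      rw [e3, e1, e2, Real.exp_add, Real.exp_add, Real.exp_add]
      ring_nf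
    have hIj := hint mj.1 mj.2
    have hIk := hint mk.1 mk.2
    have hIz := hint mz.1 mz.2
    have hIs : Integrable (fun a => Real.exp (-(f j a)) + Real.exp (-(f k a))) P := hIj.add hIk
    rw [integral_congr_ae (Eventually.of_forall e), integral_sub hIs (hIz.const_mul 2),
      integral_add hIj hIk, integral_const_mul]
    have h1 : i N ≤ J z := csInf_le (hJbdd N) ⟨z, hz, rfl⟩
    have h2 := hfJ j
    have h3 := hfJ k
    have h4 : 1 / ((j : ℝ) + 1) ≤ 1 / ((N : ℝ) + 1) := by gcongr
    have h5 : 1 / ((k : ℝ) + 1) ≤ 1 / ((N : ℝ) + 1) := by gcongr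
    simp only [hJ] at h1 h2 h3
    linarith [hiL j, hiL k]
  have hlim : Tendsto (fun N : ℕ => 2 * (L - i N + 1 / ((N : ℝ) + 1))) atTop (𝓝 0) := by
    have := (((tendsto_const_nhds (x := L)).sub hilim).add
      (tendsto_one_div_add_atTop_nhds_zero_nat (𝕜 := ℝ))).const_mul 2
    simpa using this
  -- Along this subsequence the `L²` distances are below `2 ^ (-n)`, hence summable, which upgrades
  -- `L²` Cauchy to a.e. convergence.
  obtain ⟨φ, hφ, hφ2⟩ := extraction_forall_of_eventually'
    (P := fun n N => 2 * (L - i N + 1 / ((N : ℝ) + 1)) < ((1 / 2 : ℝ) ^ n) ^ 2)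
    (fun n => by
      obtain ⟨N, hN⟩ := eventually_atTop.1 (hlim.eventually (gt_mem_nhds
        (show (0 : ℝ) < ((1 / 2 : ℝ) ^ n) ^ 2 by positivity)))
      exact ⟨N, hN⟩)
  refine ⟨fun k => f (φ k), fun k => hCanti (hφ.id_le k) (hfC (φ k)), ?_⟩
  have hm : ∀ k, AEStronglyMeasurable (fun a => Real.exp (-(f k a) / 2)) P := fun k =>
    (Real.measurable_exp.comp_aemeasurable
      ((hCprop k _ (hfC k)).1.neg.div_const 2)).aestronglyMeasurable
  refine Lp.ae_tendsto_of_cauchy_eLpNorm (p := 2) (B := fun n => ENNReal.ofReal ((1 / 2 : ℝ) ^ n))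
    (fun k => hm (φ k)) (by norm_num) ?_ ?_
  · rw [← ENNReal.ofReal_tsum_of_nonneg (fun n => by positivity) summable_geometric_two]
    exact ENNReal.ofReal_ne_top
  · intro N j k hj hk
    have h1 := hgap (φ N) (φ j) (φ k) (hφ.monotone hj) (hφ.monotone hk)
    have h2 := h1.trans_lt (hφ2 N)
    have hb : MemLp ((fun a => Real.exp (-(f (φ j) a) / 2)) - fun a => Real.exp (-(f (φ k) a) / 2))
        2 P := by
      have hbd : ∀ k, MemLp (fun a => Real.exp (-(f k a) / 2)) 2 P := fun k =>
        MemLp.of_bound (hm k) 1 (Eventually.of_forall fun a => by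
          rw [Real.norm_of_nonneg (Real.exp_pos _).le, Real.exp_le_one_iff]
          linarith [(hCprop k _ (hfC k)).2 a])
      exact (hbd _).sub (hbd _)
    rw [hb.eLpNorm_eq_integral_rpow_norm (by norm_num) (by norm_num)]
    refine (ENNReal.ofReal_lt_ofReal_iff (by positivity)).2 ?_
    simp only [ENNReal.toReal_ofNat, Pi.sub_apply, Real.norm_eq_abs, Real.rpow_ofNat, sq_abs]
    rw [← one_div, ← Real.sqrt_eq_rpow, Real.sqrt_lt' (by positivity)]
    exact h2

/-! ### The pair measure and a local Poincaré inequality -/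

section Pair

variable {n : ℕ} {g : ℝ → ℝ} {pm pp s : ℝ}

lemma pairMeasure_absolutelyContinuous : pairMeasure n ≪ (volume : Measure (Rn n × Rn n)) :=
  withDensity_absolutelyContinuous _ _

lemma aemeasurable_holderQuot {u : Rn n → ℝ} (hu : AEMeasurable u volume)
    (S : Set (Rn n × Rn n)) : AEMeasurable (holderQuot s u) ((pairMeasure n).restrict S) := by
  have h1 : AEMeasurable (holderQuot s u) (volume : Measure (Rn n × Rn n)) := by
    unfold holderQuot
    have h1 : AEMeasurable (fun p : Rn n × Rn n => u p.1) volume :=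
      hu.comp_quasiMeasurePreserving Measure.quasiMeasurePreserving_fst
    have h2 : AEMeasurable (fun p : Rn n × Rn n => u p.2) volume :=
      hu.comp_quasiMeasurePreserving Measure.quasiMeasurePreserving_snd
    refine (h1.sub h2).div ?_
    exact (Measurable.pow_const (by fun_prop) s).aemeasurable
  exact (h1.mono_ac pairMeasure_absolutelyContinuous).restrict

lemma pairModular_eq (S : Set (Rn n × Rn n)) (u : Rn n → ℝ) :
    pairModular g s S u = measModular g ((pairMeasure n).restrict S) (holderQuot s u) := rfl

lemma measurable_pairDensity :
    Measurable fun p : Rn n × Rn n => ENNReal.ofReal (1 / ‖p.1 - p.2‖ ^ n) := by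
  fun_prop

lemma pairModular_eq_lintegral (h : IsRegularDensity g pm pp) {S : Set (Rn n × Rn n)}
    (hS : MeasurableSet S) {u : Rn n → ℝ} (hu : AEMeasurable u volume) :
    pairModular g s S u = ∫⁻ p in S, ENNReal.ofReal (1 / ‖p.1 - p.2‖ ^ n) *
      ENNReal.ofReal (evenYoung g (holderQuot s u p)) := by
  have h1 : AEMeasurable (fun p => ENNReal.ofReal (evenYoung g (holderQuot s u p)))
      ((volume.restrict S).withDensity
        fun p : Rn n × Rn n => ENNReal.ofReal (1 / ‖p.1 - p.2‖ ^ n)) := by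
    have := h.aemeasurable_ofReal (aemeasurable_holderQuot (s := s) hu S)
    rwa [pairMeasure, restrict_withDensity hS] at this
  rw [pairModular_eq, measModular, pairMeasure, restrict_withDensity hS,
    lintegral_withDensity_eq_lintegral_mul₀' measurable_pairDensity.aemeasurable h1]
  rfl

/-- The increment is `|x - y| ^ s ≤ 1` times the Hölder quotient, and convexity lets this factor out
of `G`. The singular weight absorbs a further `|x - y| ^ n ≤ d ^ n`. -/
lemma ofReal_evenYoung_sub_le (h : IsRegularDensity g pm pp) (hs : 0 < s) {d : ℝ} (hd : d ≤ 1)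
    (u : Rn n → ℝ) {p : Rn n × Rn n} (hp : ‖p.1 - p.2‖ ≤ d) :
    ENNReal.ofReal (evenYoung g (u p.1 - u p.2)) ≤ ENNReal.ofReal (d ^ s * d ^ n) *
      (ENNReal.ofReal (1 / ‖p.1 - p.2‖ ^ n) *
        ENNReal.ofReal (evenYoung g (holderQuot s u p))) := by
  rcases (norm_nonneg (p.1 - p.2)).eq_or_lt with h0 | h0
  · have : p.1 = p.2 := sub_eq_zero.1 (norm_eq_zero.1 h0.symm)
    simp [this, evenYoung_zero]
  set ρ := ‖p.1 - p.2‖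
  have hρs : 0 < ρ ^ s := Real.rpow_pos_of_pos h0 s
  have hd0 : 0 < d := h0.trans_le hp
  rw [← ENNReal.ofReal_mul (by positivity), ← ENNReal.ofReal_mul (by positivity)]
  refine ENNReal.ofReal_le_ofReal ?_
  have e : u p.1 - u p.2 = ρ ^ s * holderQuot s u p := by
    rw [holderQuot, mul_div_cancel₀ _ hρs.ne']
  rw [e]
  have hY := h.evenYoung_nonneg (holderQuot s u p)
  refine (h.evenYoung_mul_le hρs.le (Real.rpow_le_one h0.le (hp.trans hd) hs.le) _).trans ?_
  rw [← mul_assoc]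
  refine mul_le_mul_of_nonneg_right ?_ hY
  rw [mul_one_div, le_div_iff₀ (by positivity)]
  gcongr

/-- Average `∫_P G(|u(x) - u(y)|) dx` over `y` in the ball. Some `y` does no worse than the average,
and `a = u y` works for it. Only `x` is confined to `P`, so the ball may leave `Ω` when this is
applied to pieces of `Ω`. -/
lemma exists_measModular_sub_const_le (h : IsRegularDensity g pm pp) (hs : 0 < s) {r : ℝ}
    (hr0 : 0 < r) (hr : 2 * r ≤ 1) {z : Rn n} {P : Set (Rn n)} (hP : MeasurableSet P)
    (hPz : P ⊆ Metric.ball z r) {u : Rn n → ℝ} (hu : AEMeasurable u volume) :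
    ∃ a : ℝ, measModular g (volume.restrict P) (fun x => u x - a) ≤
      ENNReal.ofReal ((2 * r) ^ s * (2 * r) ^ n) / volume (Metric.ball (0 : Rn n) r) *
        pairModular g s (P ×ˢ Metric.ball z r) u := by
  set B := Metric.ball z r
  have hB : MeasurableSet B := Metric.isOpen_ball.measurableSet
  have hBv : volume B = volume (Metric.ball (0 : Rn n) r) := Measure.addHaar_ball_center _ z r
  have hB0 : volume B ≠ 0 := (Metric.measure_ball_pos _ _ hr0).ne'
  have hBt : volume B ≠ ∞ := measure_ball_lt_top.ne
  have hm : AEMeasurable (fun p : Rn n × Rn n => ENNReal.ofReal (evenYoung g (u p.1 - u p.2)))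
      ((volume.restrict P).prod (volume.restrict B)) := by
    have h1 : AEMeasurable (fun p : Rn n × Rn n => u p.1) (volume.prod volume) :=
      hu.comp_quasiMeasurePreserving Measure.quasiMeasurePreserving_fst
    have h2 : AEMeasurable (fun p : Rn n × Rn n => u p.2) (volume.prod volume) :=
      hu.comp_quasiMeasurePreserving Measure.quasiMeasurePreserving_snd
    rw [Measure.prod_restrict]
    exact (h.aemeasurable_ofReal (h1.sub h2)).restrict
  obtain ⟨y, hy, hle⟩ := exists_le_setLAverage hB0 hBt hm.lintegral_prod_left'
  refine ⟨u y, le_trans hle ?_⟩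
  rw [setLAverage_eq, ← lintegral_prod_symm _ hm, Measure.prod_restrict, hBv,
    ← Measure.volume_eq_prod, ENNReal.div_eq_inv_mul, ENNReal.div_eq_inv_mul, mul_assoc]
  gcongr
  rw [pairModular_eq_lintegral h (hP.prod hB) hu, ← lintegral_const_mul' _ _ ENNReal.ofReal_ne_top]
  refine setLIntegral_mono' (hP.prod hB) fun p hp => ?_
  refine ofReal_evenYoung_sub_le h hs hr u ?_
  have h1 := Metric.mem_ball.1 (hPz hp.1)
  have h2 := Metric.mem_ball'.1 hp.2
  rw [← dist_eq_norm]
  linarith [dist_triangle p.1 z p.2]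

end Pair

/-! ### Compactness in modular on the bounded set -/

section Compactness

variable {n : ℕ} {g : ℝ → ℝ} {pm pp s : ℝ}

/-- The volume of the ball is a multiple of `r ^ n`, so the quotient is a multiple of `r ^ s`:
positive smoothness makes the Poincaré constant vanish at small scales. -/
lemma tendsto_ballConstant (n : ℕ) (hs : 0 < s) :
    Tendsto (fun r : ℝ => ENNReal.ofReal ((2 * r) ^ s * (2 * r) ^ n) /
      volume (Metric.ball (0 : Rn n) r)) (𝓝[>] 0) (𝓝 0) := by
  set ω := volume (Metric.ball (0 : Rn n) 1) with hω
  have hω0 : ω ≠ 0 := (Metric.measure_ball_pos _ _ one_pos).ne'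
  have h1 : Tendsto (fun r : ℝ => ENNReal.ofReal ((2 * r) ^ s) * (ENNReal.ofReal (2 ^ n) / ω))
      (𝓝[>] 0) (𝓝 0) := by
    have h2 : Tendsto (fun r : ℝ => (2 * r) ^ s) (𝓝 0) (𝓝 0) := by
      have : ContinuousAt (fun r : ℝ => (2 * r) ^ s) 0 :=
        ContinuousAt.rpow_const (by fun_prop) (Or.inr hs.le)
      simpa [ContinuousAt, Real.zero_rpow hs.ne'] using this
    have h3 := (ENNReal.tendsto_ofReal h2).mono_left (nhdsWithin_le_nhds (s := Ioi 0))
    have h4 := ENNReal.Tendsto.mul_const h3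
      (Or.inr (ENNReal.div_ne_top (ENNReal.ofReal_ne_top (r := 2 ^ n)) hω0))
    simpa using h4
  refine h1.congr' ?_
  filter_upwards [self_mem_nhdsWithin] with r hr
  have hr : (0 : ℝ) < r := hr
  have hrn : ENNReal.ofReal (r ^ n) ≠ 0 := (ENNReal.ofReal_pos.2 (by positivity)).ne'
  rw [Measure.addHaar_ball_of_pos _ _ hr, finrank_euclideanSpace_fin, ← hω, mul_pow,
    ENNReal.ofReal_mul (by positivity), ENNReal.ofReal_mul (by positivity), mul_div_assoc,
    mul_comm (ENNReal.ofReal (2 ^ n)), ENNReal.mul_div_mul_left _ _ hrn ENNReal.ofReal_ne_top]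

lemma exists_finite_partition_small {Ω : Set (Rn n)} (hΩ : MeasurableSet Ω)
    (hΩb : Bornology.IsBounded Ω) {r : ℝ} (hr : 0 < r) :
    ∃ (N : ℕ) (z : Fin N → Rn n) (P : Fin N → Set (Rn n)), (∀ i, MeasurableSet (P i)) ∧
      Pairwise (Function.onFun Disjoint P) ∧ ⋃ i, P i = Ω ∧ ∀ i, P i ⊆ Metric.ball (z i) r := by
  have htb : TotallyBounded Ω :=
    TotallyBounded.subset subset_closure hΩb.isCompact_closure.totallyBounded
  obtain ⟨t, ht, hcov⟩ := Metric.totallyBounded_iff.1 htb r hr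
  obtain ⟨N, z, -, rfl⟩ := ht.fin_param
  set B : Fin N → Set (Rn n) := fun i => Metric.ball (z i) r ∩ Ω
  refine ⟨N, z, disjointed B, fun i => ?_, disjoint_disjointed B, ?_, fun i =>
    (disjointed_subset B i).trans inter_subset_left⟩
  · have hB : ∀ i, MeasurableSet (B i) := fun i => Metric.isOpen_ball.measurableSet.inter hΩ
    exact disjointedRec (p := MeasurableSet) (fun t i ht => ht.diff (hB i)) (hB i)
  · have h1 : ⋃ i, disjointed B i = ⋃ i, B i := iSup_disjointed B
    rw [h1, ← iUnion_inter]
    refine inter_eq_right.2 (hcov.trans ?_)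
    rw [biUnion_range]

lemma measModular_iUnion {N : ℕ} {P : Fin N → Set (Rn n)} (hP : ∀ i, MeasurableSet (P i))
    (hd : Pairwise (Function.onFun Disjoint P)) (f : Rn n → ℝ) :
    measModular g (volume.restrict (⋃ i, P i)) f =
      ∑ i, measModular g (volume.restrict (P i)) f := by
  rw [measModular, lintegral_iUnion hP hd, tsum_fintype]
  rfl

lemma measModular_const (P : Set (Rn n)) (a : ℝ) :
    measModular g (volume.restrict P) (fun _ => a) =
      ENNReal.ofReal (evenYoung g a) * volume P := by
  rw [measModular, lintegral_const, Measure.restrict_apply_univ]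

/-- Functions with bounded energy are uniformly approximated, in the sense of the modular on `Ω`,
by step functions with bounded values on a fixed finite partition of `Ω`. -/
lemma exists_partition_approx (h : IsRegularDensity g pm pp) (hs : 0 < s) {Ω : Set (Rn n)}
    (hΩ : MeasurableSet Ω) (hΩb : Bornology.IsBounded Ω) {ε : ℝ≥0∞} (hε : ε ≠ 0) (hε' : ε ≠ ∞)
    {M : ℝ≥0∞} (hM : M ≠ ∞) :
    ∃ (N : ℕ) (P : Fin N → Set (Rn n)) (R : ℝ), (∀ i, MeasurableSet (P i)) ∧
      Pairwise (Function.onFun Disjoint P) ∧ ⋃ i, P i = Ω ∧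
      ∀ u : Rn n → ℝ, AEMeasurable u volume → measModular g (volume.restrict Ω) u ≤ M →
        pairModular g s (starSet Ω) u ≤ M →
        ∃ a : Fin N → ℝ, (∀ i, |a i| ≤ R) ∧
          ∑ i, measModular g (volume.restrict (P i)) (fun x => u x - a i) ≤ ε := by
  have h1 := ENNReal.Tendsto.mul_const (b := M) (tendsto_ballConstant n hs) (Or.inr hM)
  rw [zero_mul] at h1
  have h2 := h1.eventually (gt_mem_nhds (pos_iff_ne_zero.2 hε))
  have h3 : ∀ᶠ r : ℝ in 𝓝[>] 0, 2 * r < 1 := by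
    refine Filter.Eventually.filter_mono nhdsWithin_le_nhds ?_
    have : ContinuousAt (fun r : ℝ => 2 * r) 0 := by fun_prop
    exact this.eventually (gt_mem_nhds (by norm_num))
  obtain ⟨r, ⟨hrε, hr1⟩, hr0⟩ := ((h2.and h3).and self_mem_nhdsWithin).exists
  have hr0 : (0 : ℝ) < r := hr0
  obtain ⟨N, z, P, hP, hPd, hPu, hPz⟩ := exists_finite_partition_small hΩ hΩb hr0
  set D := ENNReal.ofReal ((2 : ℝ) ^ pp)
  -- Coercivity of `G` bounds the constant on a piece of positive volume once its modular there is
  -- controlled, uniformly in `u`.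
  have hbd : ∀ i, ∃ R : ℝ, ∀ a : ℝ, volume (P i) ≠ 0 →
      ENNReal.ofReal (evenYoung g a) * volume (P i) ≤ D * (ε + M) → |a| ≤ R := by
    intro i
    by_cases h0 : volume (P i) = 0
    · exact ⟨0, fun a ha => absurd h0 ha⟩
    have hfin : volume (P i) ≠ ∞ :=
      ((measure_mono (hPz i)).trans_lt measure_ball_lt_top).ne
    have hTfin : D * (ε + M) / volume (P i) ≠ ∞ :=
      ENNReal.div_ne_top (ENNReal.mul_ne_top ENNReal.ofReal_ne_top
        (ENNReal.add_ne_top.2 ⟨hε', hM⟩)) h0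
    obtain ⟨R, hR⟩ := (h.tendsto_evenYoung.eventually
      (eventually_gt_atTop (D * (ε + M) / volume (P i)).toReal)).exists
    refine ⟨|R|, fun a _ ha => ?_⟩
    by_contra! hlt
    have h4 := h.evenYoung_le_of_abs_le hlt.le
    rw [← ENNReal.le_div_iff_mul_le (Or.inl h0) (Or.inl hfin),
      ENNReal.ofReal_le_iff_le_toReal hTfin] at ha
    linarith
  choose R hR using hbd
  refine ⟨N, P, ∑ i, |R i|, hP, hPd, hPu, fun u hu huM huS => ?_⟩
  have hex := fun i => exists_measModular_sub_const_le h hs hr0 hr1.le (hP i) (hPz i) hu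
  choose b hb using hex
  classical
  -- On null pieces the constant does not affect the modular but could be arbitrarily large, so it
  -- is reset to zero.
  set a : Fin N → ℝ := fun i => if volume (P i) = 0 then 0 else b i with ha
  have hab : ∀ i, measModular g (volume.restrict (P i)) (fun x => u x - a i) =
      measModular g (volume.restrict (P i)) (fun x => u x - b i) := by
    intro i
    by_cases h0 : volume (P i) = 0
    · simp [measModular, Measure.restrict_eq_zero.2 h0]
    · simp [ha, h0]
  have hsum : ∑ i, measModular g (volume.restrict (P i)) (fun x => u x - a i) ≤ ε := by
    simp only [hab]
    refine (Finset.sum_le_sum fun i _ => hb i).trans ?_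
    rw [← Finset.mul_sum]
    refine le_trans ?_ hrε.le
    gcongr
    refine le_trans ?_ huS
    -- The balls may overlap, but the boxes are disjoint through their first factors. They lie in
    -- `starSet Ω` because the first coordinate is in `Ω`, so the local energies add up to at most
    -- the total one.
    have hdisj : Pairwise (Function.onFun Disjoint fun i => P i ×ˢ Metric.ball (z i) r) := fun i j hij =>
      Set.disjoint_prod.2 (Or.inl (hPd hij))
    rw [pairModular, ← tsum_fintype (L := .unconditional _)]
    simp only [pairModular]
    rw [← lintegral_iUnion (fun i => (hP i).prod Metric.isOpen_ball.measurableSet) hdisj]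
    refine lintegral_mono_set (iUnion_subset fun i p hp => ?_)
    exact fun hc => hc.1 (hPu ▸ mem_iUnion_of_mem i hp.1)
  refine ⟨a, fun i => ?_, hsum⟩
  refine le_trans ?_ (Finset.single_le_sum (f := fun i => |R i|) (fun j _ => abs_nonneg _)
    (Finset.mem_univ i))
  by_cases h0 : volume (P i) = 0
  · simp [ha, h0]
  refine le_trans (hR i (a i) h0 ?_) (le_abs_self _)
  rw [← measModular_const]
  have e : (fun _ : Rn n => a i) = (fun x => a i - u x) + u := by ext x; simp
  rw [e]
  refine (h.measModular_add_le (aemeasurable_const.sub hu.restrict)).trans ?_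
  gcongr
  · have e2 : measModular g (volume.restrict (P i)) (fun x => a i - u x) =
        measModular g (volume.restrict (P i)) (fun x => u x - a i) := by
      simp only [measModular]
      refine lintegral_congr fun x => ?_
      rw [← evenYoung_neg, neg_sub]
    exact e2.trans_le <| (Finset.single_le_sum (f := fun i => measModular g (volume.restrict (P i))
      (fun x => u x - a i)) (fun j _ => zero_le) (Finset.mem_univ i)).trans hsum
  · refine le_trans ?_ huM
    exact lintegral_mono_set (hPu ▸ subset_iUnion P i)

/-- Compactness: a sequence with bounded energy has a subsequence that is Cauchy with respect to
the modular on `Ω`. -/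
lemma exists_subseq_modular_cauchy (h : IsRegularDensity g pm pp) (hs : 0 < s) {Ω : Set (Rn n)}
    (hΩ : MeasurableSet Ω) (hΩb : Bornology.IsBounded Ω) {M : ℝ≥0∞} (hM : M ≠ ∞)
    {u : ℕ → Rn n → ℝ} (hu : ∀ k, AEMeasurable (u k) volume)
    (huM : ∀ k, measModular g (volume.restrict Ω) (u k) ≤ M)
    (huS : ∀ k, pairModular g s (starSet Ω) (u k) ≤ M) :
    ∃ φ : ℕ → ℕ, StrictMono φ ∧ ∀ ε : ℝ≥0∞, ε ≠ 0 → ∃ K, ∀ k ≥ K, ∀ l ≥ K,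
      measModular g (volume.restrict Ω) (u (φ k) - u (φ l)) ≤ ε := by
  have hδ : ∀ j : ℕ, ((j : ℝ≥0∞) + 1)⁻¹ ≠ 0 := fun j => by simp
  have hδ' : ∀ j : ℕ, ((j : ℝ≥0∞) + 1)⁻¹ ≠ ∞ := fun j => by simp
  choose N P R hP hPd hPu hPa using fun j => exists_partition_approx h hs hΩ hΩb (hδ j) (hδ' j) hM
  choose a haR ha using fun k j => hPa j (u k) (hu k) (huM k) (huS k)
  -- The step values at all accuracies `1 / (j + 1)` form one point of a countable product of
  -- compact boxes; sequential compactness of this product replaces a diagonal argument.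
  have hcomp : IsCompact (Set.pi univ fun j : ℕ =>
      Set.pi univ fun _ : Fin (N j) => Icc (-(R j)) (R j)) :=
    isCompact_univ_pi fun j => isCompact_univ_pi fun _ => isCompact_Icc
  obtain ⟨b, -, φ, hφ, hlim⟩ := hcomp.tendsto_subseq (x := a)
    (fun k j _ i _ => abs_le.1 (haR k j i))
  refine ⟨φ, hφ, fun ε hε => ?_⟩
  set D := ENNReal.ofReal ((2 : ℝ) ^ pp) with hD
  have hDt : D ≠ ∞ := ENNReal.ofReal_ne_top
  have hD0 : D ≠ 0 := (ENNReal.ofReal_pos.2 (by positivity)).ne'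
  -- Two uses of the quasi-triangle inequality, through the two step functions, turn errors `δ` into
  -- `D * (δ + D * (δ + δ)) = T * δ`.
  set T := D + 2 * (D * D)
  have hTt : T ≠ ∞ := ENNReal.add_ne_top.2
    ⟨hDt, ENNReal.mul_ne_top (by simp) (ENNReal.mul_ne_top hDt hDt)⟩
  have hT0 : T ≠ 0 := fun h0 => hD0 (add_eq_zero.1 h0).1
  obtain ⟨j, hj⟩ := ENNReal.exists_inv_nat_lt (ENNReal.div_ne_zero.2 ⟨hε, hTt⟩)
  set δ := ε / T
  have hj' : ((j : ℝ≥0∞) + 1)⁻¹ ≤ δ :=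
    (ENNReal.inv_le_inv.2 (le_self_add)).trans hj.le
  have hΩt : volume Ω ≠ ∞ := hΩb.measure_lt_top.ne
  have hY : Tendsto (fun d => ENNReal.ofReal (evenYoung g d) * volume Ω) (𝓝 0) (𝓝 0) := by
    have h1 := (ENNReal.continuous_ofReal.comp h.continuous_evenYoung).tendsto 0
    have h2 := ENNReal.Tendsto.mul_const h1 (Or.inr hΩt)
    simpa [evenYoung_zero] using h2
  have hδ0 : 0 < δ := pos_iff_ne_zero.2 (ENNReal.div_ne_zero.2 ⟨hε, hTt⟩)
  obtain ⟨η, hη, hηY⟩ := Metric.eventually_nhds_iff.1 (hY.eventually (gt_mem_nhds hδ0))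
  have hcau : CauchySeq fun k => a (φ k) j := ((tendsto_pi_nhds.1 hlim) j).cauchySeq
  obtain ⟨K, hK⟩ := Metric.cauchySeq_iff.1 hcau η hη
  refine ⟨K, fun k hk l hl => ?_⟩
  have hdist := hK k hk l hl
  have hpt : ∀ i, ENNReal.ofReal (evenYoung g (a (φ k) j i - a (φ l) j i)) ≤
      ENNReal.ofReal (evenYoung g (dist (a (φ k) j) (a (φ l) j))) := fun i => by
    refine ENNReal.ofReal_le_ofReal (h.evenYoung_le_of_abs_le ?_)
    rw [abs_of_nonneg (a := dist _ _) dist_nonneg, ← Real.dist_eq]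
    exact dist_le_pi_dist _ _ i
  have h1 : ∑ i, ENNReal.ofReal (evenYoung g (a (φ k) j i - a (φ l) j i)) * volume (P j i) ≤ δ := by
    calc _ ≤ ∑ i, ENNReal.ofReal (evenYoung g (dist (a (φ k) j) (a (φ l) j))) *
            volume (P j i) := Finset.sum_le_sum fun i _ => mul_le_mul' (hpt i) le_rfl
      _ = ENNReal.ofReal (evenYoung g (dist (a (φ k) j) (a (φ l) j))) * volume Ω := by
          rw [← Finset.mul_sum, ← hPu j, measure_iUnion (hPd j) (hP j), tsum_fintype]
      _ ≤ δ := (hηY (by simpa [abs_of_nonneg, dist_nonneg] using hdist)).le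
  have hpiece : ∀ i, measModular g (volume.restrict (P j i)) (u (φ k) - u (φ l)) ≤
      D * (measModular g (volume.restrict (P j i)) (fun x => u (φ k) x - a (φ k) j i) +
        D * (ENNReal.ofReal (evenYoung g (a (φ k) j i - a (φ l) j i)) * volume (P j i) +
          measModular g (volume.restrict (P j i)) (fun x => u (φ l) x - a (φ l) j i))) := by
    intro i
    have e : u (φ k) - u (φ l) = (fun x => u (φ k) x - a (φ k) j i) +
        ((fun _ => a (φ k) j i - a (φ l) j i) + fun x => a (φ l) j i - u (φ l) x) := by
      ext x; simp
    have e2 : measModular g (volume.restrict (P j i)) (fun x => u (φ l) x - a (φ l) j i) =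
        measModular g (volume.restrict (P j i)) (fun x => a (φ l) j i - u (φ l) x) := by
      simp only [measModular]
      refine lintegral_congr fun x => ?_
      rw [← evenYoung_neg, neg_sub]
    rw [e, e2, ← measModular_const]
    refine (h.measModular_add_le ((hu _).restrict.sub aemeasurable_const)).trans ?_
    gcongr
    · exact le_rfl
    · exact h.measModular_add_le aemeasurable_const
  calc measModular g (volume.restrict Ω) (u (φ k) - u (φ l))
      = ∑ i, measModular g (volume.restrict (P j i)) (u (φ k) - u (φ l)) := by
        rw [← hPu j, measModular_iUnion (hP j) (hPd j)]
    _ ≤ _ := Finset.sum_le_sum fun i _ => hpiece i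
    _ ≤ D * (δ + D * (δ + δ)) := by
        rw [← Finset.mul_sum, Finset.sum_add_distrib, ← Finset.mul_sum, Finset.sum_add_distrib]
        gcongr
        · exact (ha (φ k) j).trans hj'
        · exact (ha (φ l) j).trans hj'
    _ = T * δ := by ring
    _ = ε := ENNReal.mul_div_cancel hT0 hTt

end Compactness

/-! ### Convexity and lower semicontinuity of the energy -/

lemma liminf_add_liminf_le (a b : ℕ → ℝ≥0∞) :
    liminf a atTop + liminf b atTop ≤ liminf (fun k => a k + b k) atTop := by
  simp only [liminf_eq_iSup_iInf_of_nat]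
  rw [ENNReal.iSup_add_iSup_of_monotone
    (fun i j hij => biInf_mono fun k hk => le_trans hij hk)
    (fun i j hij => biInf_mono fun k hk => le_trans hij hk)]
  exact iSup_mono fun i => le_iInf₂ fun k hk => add_le_add (iInf₂_le k hk) (iInf₂_le k hk)

/-- Used to carry bounds on a sequence over to every element of the convex hulls of its tails. -/
lemma convex_sublevel {E : Type*} [AddCommGroup E] [Module ℝ E] {A : Set E} (hA : Convex ℝ A)
    {Q : E → ℝ≥0∞} (hQ : ∀ f ∈ A, ∀ k ∈ A, ∀ a b : ℝ, 0 ≤ a → 0 ≤ b → a + b = 1 →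
      Q (a • f + b • k) ≤ ENNReal.ofReal a * Q f + ENNReal.ofReal b * Q k) (c : ℝ≥0∞) :
    Convex ℝ {f | f ∈ A ∧ Q f ≤ c} := by
  rintro f ⟨hf, hfc⟩ k ⟨hk, hkc⟩ a b ha hb hab
  refine ⟨hA hf hk ha hb hab, (hQ f hf k hk a b ha hb hab).trans ?_⟩
  calc _ ≤ ENNReal.ofReal a * c + ENNReal.ofReal b * c := by gcongr
    _ = c := by rw [← add_mul, ← ENNReal.ofReal_add ha hb, hab, ENNReal.ofReal_one, one_mul]

section Energy

variable {n : ℕ} {g : ℝ → ℝ} {pm pp s : ℝ}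

lemma holderQuot_add (u v : Rn n → ℝ) :
    holderQuot s (u + v) = holderQuot s u + holderQuot s v := by
  ext p
  simp only [holderQuot, Pi.add_apply]
  ring

lemma holderQuot_smul (c : ℝ) (u : Rn n → ℝ) : holderQuot s (c • u) = c • holderQuot s u := by
  ext p
  simp only [holderQuot, Pi.smul_apply, smul_eq_mul]
  ring

/-- The reverse triangle inequality. It allows minimizing sequences to be taken nonnegative. -/
lemma pairModular_abs_le (h : IsRegularDensity g pm pp) (S : Set (Rn n × Rn n)) (u : Rn n → ℝ) :
    pairModular g s S (fun x => |u x|) ≤ pairModular g s S u := by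
  refine h.measModular_mono fun p => ?_
  rw [holderQuot, holderQuot, abs_div, abs_div]
  exact div_le_div_of_nonneg_right (abs_abs_sub_abs_le_abs_sub (u p.1) (u p.2)) (abs_nonneg _)

lemma pairModular_le_liminf (h : IsRegularDensity g pm pp) (S : Set (Rn n × Rn n))
    {f : ℕ → Rn n → ℝ} {u : Rn n → ℝ} (hf : ∀ k, AEMeasurable (f k) volume)
    (hu : ∀ᵐ x, Tendsto (fun k => f k x) atTop (𝓝 (u x))) :
    pairModular g s S u ≤ liminf (fun k => pairModular g s S (f k)) atTop := by
  refine h.measModular_le_liminf (fun k => aemeasurable_holderQuot (hf k) S) ?_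
  refine ae_restrict_of_ae (pairMeasure_absolutelyContinuous.ae_le ?_)
  have h1 : ∀ᵐ p : Rn n × Rn n, Tendsto (fun k => f k p.1) atTop (𝓝 (u p.1)) :=
    Measure.quasiMeasurePreserving_fst.ae hu
  have h2 : ∀ᵐ p : Rn n × Rn n, Tendsto (fun k => f k p.2) atTop (𝓝 (u p.2)) :=
    Measure.quasiMeasurePreserving_snd.ae hu
  filter_upwards [h1, h2] with p hp1 hp2
  exact (hp1.sub hp2).div_const _

/-- The energy `Φ_S(u) + ∫ G(|u|) dm`. -/
noncomputable def energy (g : ℝ → ℝ) (s : ℝ) (S : Set (Rn n × Rn n)) (m : Measure (Rn n))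
    (u : Rn n → ℝ) : ℝ≥0∞ :=
  pairModular g s S u + measModular g m u

lemma energy_convex_le (h : IsRegularDensity g pm pp) (S : Set (Rn n × Rn n))
    {m : Measure (Rn n)} (hm : m ≪ volume) {f k : Rn n → ℝ} (hf : AEMeasurable f volume)
    {a b : ℝ} (ha : 0 ≤ a) (hb : 0 ≤ b) (hab : a + b = 1) :
    energy g s S m (a • f + b • k) ≤
      ENNReal.ofReal a * energy g s S m f + ENNReal.ofReal b * energy g s S m k := by
  have h1 := h.measModular_convex_le (k := holderQuot s k) (aemeasurable_holderQuot (s := s) hf S)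
    ha hb hab
  have h2 := h.measModular_convex_le (k := k) (hf.mono_ac hm) ha hb hab
  rw [← holderQuot_smul, ← holderQuot_smul, ← holderQuot_add] at h1
  refine (add_le_add h1 h2).trans_eq ?_
  simp only [energy, pairModular_eq]
  ring

lemma energy_smul_le (h : IsRegularDensity g pm pp) (S : Set (Rn n × Rn n)) (m : Measure (Rn n))
    {c : ℝ} (hc0 : 0 ≤ c) (hc1 : c ≤ 1) (f : Rn n → ℝ) :
    energy g s S m (c • f) ≤ energy g s S m f := by
  refine add_le_add ?_ (h.measModular_smul_le_self hc0 hc1 f)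
  rw [pairModular_eq, holderQuot_smul]
  exact h.measModular_smul_le_self hc0 hc1 _

lemma energy_le_of_tendsto (h : IsRegularDensity g pm pp) (S : Set (Rn n × Rn n))
    {m : Measure (Rn n)} (hm : m ≪ volume) {f : ℕ → Rn n → ℝ} {u : Rn n → ℝ}
    (hf : ∀ k, AEMeasurable (f k) volume)
    (hu : ∀ᵐ x, Tendsto (fun k => f k x) atTop (𝓝 (u x))) :
    energy g s S m u ≤ liminf (fun k => energy g s S m (f k)) atTop :=
  (add_le_add (pairModular_le_liminf h S hf hu)
    (h.measModular_le_liminf (fun k => (hf k).mono_ac hm) (hm.ae_le hu))).trans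
    (liminf_add_liminf_le _ _)

/-- Lower bound for the modular of a limit in the sense of the modular. -/
lemma le_measModular_of_approx (h : IsRegularDensity g pm pp) {α : Type*} [MeasurableSpace α]
    {m : Measure α} {u : α → ℝ} (hu : AEMeasurable u m) (hu' : measModular g m u ≠ ∞) {c : ℝ≥0∞}
    (hc : ∀ ε : ℝ≥0∞, ε ≠ 0 → ∃ v : α → ℝ, c ≤ measModular g m v ∧
      measModular g m (v - u) ≤ ε) : c ≤ measModular g m u := by
  -- Write `v` as the convex combination of `u / (1 - θ)` and `(v - u) / θ`. Δ₂ costs `θ ^ (-pp)` on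
  -- the error term, which is why `v` is chosen within `δ / K`; afterwards `θ` tends to zero.
  have key : ∀ θ : ℝ, 0 < θ → θ < 1 →
      c ≤ ENNReal.ofReal (((1 - θ)⁻¹) ^ pp) * measModular g m u := by
    intro θ hθ0 hθ1
    have h1θ : 0 < 1 - θ := sub_pos.2 hθ1
    refine le_of_forall_pos_le_add fun δ hδ => ?_
    set K := ENNReal.ofReal (θ⁻¹ ^ pp) with hK
    have hK0 : K ≠ 0 := (ENNReal.ofReal_pos.2 (by positivity)).ne'
    have hKt : K ≠ ∞ := ENNReal.ofReal_ne_top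
    obtain ⟨v, hv1, hv2⟩ := hc (δ / K) (ENNReal.div_ne_zero.2 ⟨hδ.ne', hKt⟩)
    have e : v = (1 - θ) • ((1 - θ)⁻¹ • u) + θ • (θ⁻¹ • (v - u)) := by
      rw [smul_inv_smul₀ h1θ.ne', smul_inv_smul₀ hθ0.ne', add_sub_cancel]
    have h2 := h.measModular_convex_le (k := θ⁻¹ • (v - u)) (hu.const_smul (1 - θ)⁻¹) h1θ.le
      hθ0.le (by ring)
    rw [← e] at h2
    refine hv1.trans (h2.trans (add_le_add ?_ ?_))
    · refine (mul_le_of_le_one_left' ?_).trans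
        (h.measModular_smul_le_rpow (one_le_inv_iff₀.2 ⟨h1θ, by linarith⟩) u)
      exact ENNReal.ofReal_le_one.2 (by linarith)
    · refine (mul_le_of_le_one_left' (ENNReal.ofReal_le_one.2 hθ1.le)).trans
        ((h.measModular_smul_le_rpow (one_le_inv_iff₀.2 ⟨hθ0, hθ1.le⟩) _).trans ?_)
      calc K * measModular g m (v - u) ≤ K * (δ / K) := by gcongr
        _ = δ := ENNReal.mul_div_cancel hK0 hKt
  have hlim : Tendsto (fun θ : ℝ => ENNReal.ofReal (((1 - θ)⁻¹) ^ pp) * measModular g m u)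
      (𝓝[>] 0) (𝓝 (measModular g m u)) := by
    have h1 : ContinuousAt (fun θ : ℝ => ((1 - θ)⁻¹) ^ pp) 0 := by
      refine ContinuousAt.rpow_const (ContinuousAt.inv₀ (by fun_prop) (by norm_num)) ?_
      left; norm_num
    have h2 := ENNReal.Tendsto.mul_const (ENNReal.tendsto_ofReal h1.tendsto) (Or.inr hu')
    simp only [sub_zero, inv_one, Real.one_rpow, ENNReal.ofReal_one, one_mul] at h2
    exact h2.mono_left nhdsWithin_le_nhds
  refine ge_of_tendsto hlim ?_
  filter_upwards [Ioo_mem_nhdsGT (zero_lt_one' ℝ)] with θ hθ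
  exact key θ hθ.1 hθ.2

/-- A zero limit of the exponentials would mean `f k a → ∞`, hence `G(f k a) → ∞`; by Fatou and the
modular bound this happens only on a null set. Elsewhere take logarithms. -/
lemma exists_ae_tendsto_of_exp (h : IsRegularDensity g pm pp) {α : Type*} [MeasurableSpace α]
    {m : Measure α} {f : ℕ → α → ℝ} (hf : ∀ k, AEMeasurable (f k) m) (hf0 : ∀ k a, 0 ≤ f k a)
    (hl : ∀ᵐ a ∂m, ∃ l : ℝ, Tendsto (fun k => Real.exp (-(f k a) / 2)) atTop (𝓝 l))
    {M : ℝ≥0∞} (hM : M ≠ ∞) (hfM : ∀ k, measModular g m (f k) ≤ M) :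
    ∀ᵐ a ∂m, ∃ l : ℝ, 0 ≤ l ∧ Tendsto (fun k => f k a) atTop (𝓝 l) := by
  have hmeas : AEMeasurable
      (fun a => liminf (fun k => ENNReal.ofReal (evenYoung g (f k a))) atTop) m := by
    simp only [liminf_eq_iSup_iInf_of_nat]
    exact .iSup fun i => .biInf _ (to_countable _) fun k _ => h.aemeasurable_ofReal (hf k)
  have hfin : ∫⁻ a, liminf (fun k => ENNReal.ofReal (evenYoung g (f k a))) atTop ∂m ≠ ∞ := by
    refine ne_top_of_le_ne_top hM ((lintegral_liminf_le' fun k => h.aemeasurable_ofReal (hf k)).trans ?_)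
    exact liminf_le_of_le (by isBoundedDefault) fun b hb => by
      obtain ⟨k, hk⟩ := hb.exists
      exact hk.trans (hfM k)
  filter_upwards [hl, ae_lt_top' hmeas hfin] with a ⟨l, hla⟩ hlt
  have hl0 : 0 ≤ l := ge_of_tendsto' hla fun k => (Real.exp_pos _).le
  rcases hl0.eq_or_lt with rfl | hl0
  · exfalso
    have h1 : Tendsto (fun k => -(f k a) / 2) atTop atBot := Real.tendsto_exp_comp_nhds_zero.1 hla
    have h2 : Tendsto (fun k => f k a) atTop atTop := by
      have h3 := (tendsto_neg_atBot_atTop.comp h1).atTop_mul_const (two_pos (α := ℝ))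
      refine h3.congr fun k => ?_
      simp only [Function.comp_apply]
      ring
    have h3 := ENNReal.tendsto_ofReal_atTop.comp (h.tendsto_evenYoung.comp h2)
    exact hlt.ne h3.liminf_eq
  · have h1 := ((Real.continuousAt_log hl0.ne').tendsto.comp hla).const_mul (-2)
    refine ⟨-2 * Real.log l, ?_, h1.congr fun k => ?_⟩
    · refine ge_of_tendsto' h1 fun k => ?_
      simp only [Function.comp_apply, Real.log_exp]
      linarith [hf0 k a]
    · simp only [Function.comp_apply, Real.log_exp]
      ring

end Energy

/-! ### Existence of minimizers and the Euler-Lagrange equation -/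

section Minimizer

variable {n : ℕ} {g : ℝ → ℝ} {pm pp s : ℝ}

/-- The functions with finite modular on `Ω` and finite energy, as a linear space. -/
def energySpace (h : IsRegularDensity g pm pp) (s : ℝ) (Ω : Set (Rn n)) (S : Set (Rn n × Rn n))
    {m : Measure (Rn n)} (hm : m ≪ volume) : Submodule ℝ (Rn n → ℝ) where
  carrier := {u | AEMeasurable u volume ∧ measModular g (volume.restrict Ω) u < ∞ ∧
    pairModular g s S u < ∞ ∧ measModular g m u < ∞}
  zero_mem' := by
    refine ⟨aemeasurable_const (b := (0 : ℝ)), ?_, ?_, ?_⟩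
    · simp [measModular_zero]
    · have : holderQuot s (0 : Rn n → ℝ) = 0 := by ext p; simp [holderQuot]
      rw [pairModular_eq, this, measModular_zero]
      exact ENNReal.zero_lt_top
    · simp [measModular_zero]
  add_mem' := by
    rintro u v ⟨hu1, hu2, hu3, hu4⟩ ⟨hv1, hv2, hv3, hv4⟩
    refine ⟨hu1.add hv1, h.measModular_add_lt_top hu1.restrict hu2 hv2, ?_,
      h.measModular_add_lt_top (hu1.mono_ac hm) hu4 hv4⟩
    rw [pairModular_eq, holderQuot_add]
    exact h.measModular_add_lt_top (aemeasurable_holderQuot hu1 S) hu3 hv3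
  smul_mem' := by
    rintro c u ⟨hu1, hu2, hu3, hu4⟩
    refine ⟨hu1.const_smul c, h.measModular_smul_lt_top c hu2, ?_, h.measModular_smul_lt_top c hu4⟩
    rw [pairModular_eq, holderQuot_smul]
    exact h.measModular_smul_lt_top c hu3

variable {Ω : Set (Rn n)} {S : Set (Rn n × Rn n)} {m : Measure (Rn n)}

lemma energy_lt_top (h : IsRegularDensity g pm pp) {hm : m ≪ volume} {u : Rn n → ℝ}
    (hu : u ∈ energySpace h s Ω S hm) : energy g s S m u < ∞ :=
  ENNReal.add_lt_top.2 ⟨hu.2.2.1, hu.2.2.2⟩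

/-- Existence of nonnegative minimizers of the energy at a given level. -/
theorem exists_energy_minimizer (h : IsRegularDensity g pm pp) (hs : 0 < s)
    (hΩ : MeasurableSet Ω) (hΩb : Bornology.IsBounded Ω) (hS : starSet Ω ⊆ S)
    (hm : m ≪ volume) (hm' : volume.restrict Ωᶜ ≪ m) {μ : ℝ}
    (hne : ∃ w ∈ energySpace h s Ω S hm, measModular g (volume.restrict Ω) w = ENNReal.ofReal μ) :
    ∃ u ∈ energySpace h s Ω S hm, (∀ x, 0 ≤ u x) ∧
      measModular g (volume.restrict Ω) u = ENNReal.ofReal μ ∧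
      ∀ w ∈ energySpace h s Ω S hm, measModular g (volume.restrict Ω) w = ENNReal.ofReal μ →
        energy g s S m u ≤ energy g s S m w := by
  set Λ : Set (Rn n → ℝ) := {w | w ∈ energySpace h s Ω S hm ∧
    measModular g (volume.restrict Ω) w = ENNReal.ofReal μ}
  set i := sInf (energy g s S m '' Λ) with hi
  obtain ⟨w₀, hw₀, hw₀μ⟩ := hne
  have hit : i ≠ ∞ := ((sInf_le (mem_image_of_mem _ (show w₀ ∈ Λ from ⟨hw₀, hw₀μ⟩))).trans_lt
    (energy_lt_top h hw₀)).ne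
  have hex : ∀ k : ℕ, ∃ w ∈ Λ, energy g s S m w < i + ((k : ℝ≥0∞) + 1)⁻¹ := by
    intro k
    obtain ⟨_, ⟨w, hw, rfl⟩, hlt⟩ := sInf_lt_iff.1
      (show sInf (energy g s S m '' Λ) < i + ((k : ℝ≥0∞) + 1)⁻¹ from
        ENNReal.lt_add_right hit (by simp))
    exact ⟨w, hw, hlt⟩
  choose w hwΛ hwi using hex
  set u : ℕ → Rn n → ℝ := fun k x => |w k x|
  have hu : ∀ k, AEMeasurable (u k) volume := fun k =>
    continuous_abs.measurable.comp_aemeasurable (hwΛ k).1.1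
  have hu0 : ∀ k x, 0 ≤ u k x := fun k x => abs_nonneg _
  have huΩ : ∀ k, measModular g (volume.restrict Ω) (u k) = ENNReal.ofReal μ := fun k =>
    (measModular_abs _).trans (hwΛ k).2
  have hui : ∀ k, energy g s S m (u k) ≤ i + ((k : ℝ≥0∞) + 1)⁻¹ := fun k =>
    (add_le_add (pairModular_abs_le h S (w k)) (measModular_abs _).le).trans (hwi k).le
  have hinv : ∀ k : ℕ, ((k : ℝ≥0∞) + 1)⁻¹ ≤ 1 := fun k => by
    rw [ENNReal.inv_le_one]; exact le_add_self
  set M := ENNReal.ofReal μ + (i + 1) with hMdef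
  have hM : M ≠ ∞ := by simp [M, hit]
  obtain ⟨φ, hφ, hcau⟩ := exists_subseq_modular_cauchy h hs hΩ hΩb hM hu
    (fun k => (huΩ k).le.trans le_self_add)
    (fun k => (lintegral_mono_set hS).trans (le_self_add.trans
      ((hui k).trans ((add_le_add_right (hinv k) i).trans le_add_self))))
  set v : ℕ → Rn n → ℝ := fun k => u (φ k) with hv
  have hvm : ∀ k, AEMeasurable (v k) volume := fun k => hu (φ k)
  -- The convergence lemma needs a finite measure, and a.e. statements only depend on the null sets,
  -- so Lebesgue measure is replaced by an equivalent finite one.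
  have hvac : (volume : Measure (Rn n)) ≪ volume.toFinite := absolutelyContinuous_toFinite _
  have hvac' : (volume : Measure (Rn n)).toFinite ≪ volume := toFinite_absolutelyContinuous _
  obtain ⟨f, hfC, hfl⟩ := exists_convexHull_ae_tendsto_exp (P := (volume : Measure (Rn n)).toFinite)
    (fun k => (hvm k).mono_ac hvac') (fun k x => hu0 (φ k) x)
  have hA : Convex ℝ {f : Rn n → ℝ | AEMeasurable f volume ∧ ∀ x, 0 ≤ f x} := by
    intro f hf k hk a b ha hb _
    exact ⟨(hf.1.const_smul a).add (hk.1.const_smul b), fun x =>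
      add_nonneg (mul_nonneg ha (hf.2 x)) (mul_nonneg hb (hk.2 x))⟩
  have hvA : ∀ k, v k ∈ {f : Rn n → ℝ | AEMeasurable f volume ∧ ∀ x, 0 ≤ f x} := fun k =>
    ⟨hvm k, fun x => hu0 (φ k) x⟩
  have hfA : ∀ k, f k ∈ {f : Rn n → ℝ | AEMeasurable f volume ∧ ∀ x, 0 ≤ f x} := fun k =>
    convexHull_min (by rintro _ ⟨j, _, rfl⟩; exact hvA j) hA (hfC k)
  have hfE : ∀ k : ℕ, energy g s S m (f k) ≤ i + ((k : ℝ≥0∞) + 1)⁻¹ := by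
    intro k
    have hc := convex_sublevel hA (Q := energy g s S m)
      (fun f hf k _ a b ha hb hab => energy_convex_le h S hm hf.1 ha hb hab)
      (i + ((k : ℝ≥0∞) + 1)⁻¹)
    refine (convexHull_min ?_ hc (hfC k)).2
    rintro _ ⟨j, hj, rfl⟩
    refine ⟨hvA j, (hui (φ j)).trans ?_⟩
    have hkj : (k : ℝ≥0∞) ≤ φ j := by exact_mod_cast (mem_Ici.1 hj).trans (hφ.id_le j)
    gcongr
  have hfΩ : ∀ k : ℕ, measModular g (volume.restrict Ω) (f k) ≤ ENNReal.ofReal μ := by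
    intro k
    have hc := convex_sublevel hA (Q := measModular g (volume.restrict Ω))
      (fun f hf k _ a b ha hb hab => h.measModular_convex_le hf.1.restrict ha hb hab)
      (ENNReal.ofReal μ)
    refine (convexHull_min ?_ hc (hfC k)).2
    rintro _ ⟨j, hj, rfl⟩
    exact ⟨hvA j, (huΩ _).le⟩
  -- The map `f ↦ ∫_Ω G(|v j - f|)` is convex, so closeness of `v j` to the tail passes to convex
  -- combinations of the tail.
  have hfv : ∀ (j k : ℕ) (ε : ℝ≥0∞),
      (∀ l ≥ k, measModular g (volume.restrict Ω) (v j - v l) ≤ ε) →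
      measModular g (volume.restrict Ω) (v j - f k) ≤ ε := by
    intro j k ε hε
    have hc := convex_sublevel hA (Q := fun f => measModular g (volume.restrict Ω) (v j - f))
      (fun f hf k _ a b ha hb hab => by
        have e : v j - (a • f + b • k) = a • (v j - f) + b • (v j - k) := by
          have : v j = a • v j + b • v j := by rw [← add_smul, hab, one_smul]
          nth_rewrite 1 [this]
          rw [smul_sub, smul_sub]
          abel
        simp only [e]
        exact h.measModular_convex_le ((hvm j).sub hf.1).restrict ha hb hab) ε
    refine (convexHull_min ?_ hc (hfC k)).2
    rintro _ ⟨l, hl, rfl⟩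
    exact ⟨hvA l, hε l hl⟩
  -- The two modulars bounded along `f` together see all of `ℝⁿ`, because `m` charges every non-null
  -- part of the complement of `Ω`. Hence the limits are finite Lebesgue-a.e.
  have hac : (volume : Measure (Rn n)) ≪ volume.restrict Ω + m := by
    intro A hA0
    rw [Measure.add_apply, add_eq_zero] at hA0
    rw [← Measure.restrict_add_restrict_compl (μ := (volume : Measure (Rn n))) hΩ,
      Measure.add_apply, hA0.1, hm' hA0.2, add_zero]
  have hac' : volume.restrict Ω + m ≪ (volume : Measure (Rn n)) :=
    Measure.AbsolutelyContinuous.add_left Measure.absolutelyContinuous_restrict hm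
  have hlim := exists_ae_tendsto_of_exp h (m := volume.restrict Ω + m) (M := M)
    (fun k => (hfA k).1.mono_ac hac') (fun k => (hfA k).2)
    (hac'.ae_le (hvac.ae_le hfl)) hM (fun k => by
      rw [measModular, lintegral_add_measure]
      refine add_le_add (hfΩ k) ?_
      exact le_add_self.trans ((hfE k).trans (add_le_add_right (hinv k) i)))
  have hlim := hac.ae_le hlim
  classical
  -- The default value `0` makes the limit nonnegative at every point, not just almost everywhere.
  set z : Rn n → ℝ := fun x => if hx : ∃ l : ℝ, 0 ≤ l ∧ Tendsto (fun k => f k x) atTop (𝓝 l)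
    then hx.choose else 0 with hz
  have hz0 : ∀ x, 0 ≤ z x := by
    intro x
    simp only [hz]
    split_ifs with hx
    · exact hx.choose_spec.1
    · exact le_rfl
  have hzlim : ∀ᵐ x, Tendsto (fun k => f k x) atTop (𝓝 (z x)) := by
    filter_upwards [hlim] with x hx
    simp only [hz, dif_pos hx]
    exact hx.choose_spec.2
  have hzm : AEMeasurable z volume :=
    aemeasurable_of_tendsto_metrizable_ae' (fun k => (hfA k).1) hzlim
  have hzE : energy g s S m z ≤ i := by
    refine (energy_le_of_tendsto h S hm (fun k => (hfA k).1) hzlim).trans ?_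
    have h1 : Tendsto (fun k : ℕ => i + ((k : ℝ≥0∞) + 1)⁻¹) atTop (𝓝 i) := by
      have h2 := (tendsto_add_atTop_iff_nat 1).2 ENNReal.tendsto_inv_nat_nhds_zero
      have h3 := h2.const_add i
      simpa using h3
    rw [← h1.liminf_eq]
    exact liminf_le_liminf (Eventually.of_forall hfE)
  have hzΩle : measModular g (volume.restrict Ω) z ≤ ENNReal.ofReal μ :=
    h.measModular_le_of_tendsto (fun k => (hfA k).1.restrict) (ae_restrict_of_ae hzlim)
      (Eventually.of_forall hfΩ)
  -- Fatou only gives `≤`. For `≥`, the functions `v K` sit exactly at the level and are close to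
  -- `z` in modular, by Fatou applied to `v K - f k`.
  have hzΩ : measModular g (volume.restrict Ω) z = ENNReal.ofReal μ := by
    refine le_antisymm hzΩle (le_measModular_of_approx h hzm.restrict
      (ne_top_of_le_ne_top ENNReal.ofReal_ne_top hzΩle) fun ε hε => ?_)
    obtain ⟨K, hK⟩ := hcau ε hε
    refine ⟨v K, (huΩ _).ge, ?_⟩
    refine h.measModular_le_of_tendsto (f := fun k => v K - f k)
      (fun k => ((hvm K).sub (hfA k).1).restrict) ?_
      (eventually_atTop.2 ⟨K, fun k hk => hfv K k ε fun l hl => hK K le_rfl l (hk.trans hl)⟩)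
    filter_upwards [ae_restrict_of_ae hzlim] with x hx
    exact hx.const_sub _
  have hzt : energy g s S m z < ∞ := hzE.trans_lt hit.lt_top
  refine ⟨z, ⟨hzm, ?_, le_self_add.trans_lt hzt, le_add_self.trans_lt hzt⟩, hz0, hzΩ,
    fun y hy hyμ => hzE.trans (sInf_le ⟨y, ⟨hy, hyμ⟩, rfl⟩)⟩
  rw [hzΩ]
  exact ENNReal.ofReal_lt_top

lemma hasDerivAt_pairModular (h : IsRegularDensity g pm pp) {u v : Rn n → ℝ}
    (hu : AEMeasurable u volume) (hv : AEMeasurable v volume)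
    (hu' : pairModular g s S u < ∞) (hv' : pairModular g s S v < ∞) :
    HasDerivAt (fun t : ℝ => (pairModular g s S (u + t • v)).toReal) (pairForm g s S u v) 0 := by
  have := h.hasDerivAt_measModular (aemeasurable_holderQuot (s := s) hu S)
    (aemeasurable_holderQuot (s := s) hv S) hu' hv'
  simp only [← holderQuot_smul, ← holderQuot_add] at this
  exact this

/-- Minimizers of the energy at a level satisfy the Euler-Lagrange equation. -/
theorem exists_multiplier_of_minimizer (h : IsRegularDensity g pm pp) (hm : m ≪ volume)
    {μ : ℝ} (hμ : 0 < μ) {u : Rn n → ℝ} (hu : u ∈ energySpace h s Ω S hm)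
    (huμ : measModular g (volume.restrict Ω) u = ENNReal.ofReal μ)
    (hmin : ∀ w ∈ energySpace h s Ω S hm,
      measModular g (volume.restrict Ω) w = ENNReal.ofReal μ →
        energy g s S m u ≤ energy g s S m w) :
    ∃ L : ℝ, 0 ≤ L ∧ ∀ v ∈ energySpace h s Ω S hm,
      pairForm g s S u v + ∫ x, oddExt g (u x) * v x ∂m = L * lowerForm g Ω u v := by
  have hgen : ∀ {α : Type} [MeasurableSpace α] (m : Measure α) (f k l : α → ℝ),
      AEMeasurable f m → AEMeasurable k m → AEMeasurable l m → measModular g m f < ∞ →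
      measModular g m k < ∞ → measModular g m l < ∞ → ∀ a b : ℝ,
      ∫ x, oddExt g (f x) * (a • k + b • l) x ∂m =
        a * ∫ x, oddExt g (f x) * k x ∂m + b * ∫ x, oddExt g (f x) * l x ∂m := by
    intro α _ m f k l hf hk hl hf' hk' hl' a b
    rw [← integral_const_mul, ← integral_const_mul, ← integral_add
      ((h.integrable_oddExt_mul hf hk hf' hk').const_mul a)
      ((h.integrable_oddExt_mul hf hl hf' hl').const_mul b)]
    refine integral_congr_ae (Eventually.of_forall fun x => ?_)
    simp only [Pi.add_apply, Pi.smul_apply, smul_eq_mul]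
    ring
  have hpair : ∀ v ∈ energySpace h s Ω S hm, ∀ a b : ℝ,
      pairForm g s S u (a • v + b • u) = a * pairForm g s S u v + b * pairForm g s S u u := by
    intro v hv a b
    simp only [pairForm, holderQuot_add, holderQuot_smul]
    exact hgen _ _ _ _ (aemeasurable_holderQuot hu.1 S) (aemeasurable_holderQuot hv.1 S)
      (aemeasurable_holderQuot hu.1 S) hu.2.2.1 hv.2.2.1 hu.2.2.1 a b
  have hlow : μ ≤ lowerForm g Ω u u := by
    have h1 := h.toReal_measModular_le_integral hu.1.restrict hu.2.1
    rwa [huμ, ENNReal.toReal_ofReal hμ.le] at h1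
  have key := lagrange_multiplier (X := energySpace h s Ω S hm)
    (F := fun v => (pairModular g s S v).toReal + (measModular g m v).toReal)
    (I := fun v => (measModular g (volume.restrict Ω) v).toReal)
    (A := fun v => pairForm g s S u v + ∫ x, oddExt g (u x) * v x ∂m)
    (B := fun v => lowerForm g Ω u v) hu
    (fun v hv => (hasDerivAt_pairModular h hu.1 hv.1 hu.2.2.1 hv.2.2.1).add
      (h.hasDerivAt_measModular (hu.1.mono_ac hm) (hv.1.mono_ac hm) hu.2.2.2 hv.2.2.2))
    (fun v hv => h.hasDerivAt_measModular hu.1.restrict hv.1.restrict hu.2.1 hv.2.1)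
    (fun v hv a b => by
      rw [hpair v hv a b, hgen m u v u (hu.1.mono_ac hm) (hv.1.mono_ac hm) (hu.1.mono_ac hm)
        hu.2.2.2 hv.2.2.2 hu.2.2.2 a b]
      ring)
    (fun v hv a b => hgen _ u v u hu.1.restrict hv.1.restrict hu.1.restrict hu.2.1 hv.2.1 hu.2.1 a b)
    -- Scaling down to the level uses a factor in `[0, 1]`, under which the energy does not
    -- increase.
    (fun z hz hle => by
      rw [ENNReal.toReal_le_toReal hu.2.1.ne hz.2.1.ne, huμ] at hle
      obtain ⟨c, hc, hceq⟩ := h.exists_smul_measModular_eq hz.1.restrict hz.2.1 hμ.le hle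
      refine ⟨c, by rw [hceq, huμ], ?_⟩
      have hcz := (energySpace h s Ω S hm).smul_mem c hz
      have h1 := energy_smul_le (s := s) h S m hc.1 hc.2 z
      have h2 := (ENNReal.toReal_le_toReal (energy_lt_top h hcz).ne (energy_lt_top h hz).ne).2 h1
      rwa [energy, energy, ENNReal.toReal_add hcz.2.2.1.ne hcz.2.2.2.ne,
        ENNReal.toReal_add hz.2.2.1.ne hz.2.2.2.ne] at h2)
    (fun z hz heq => by
      rw [ENNReal.toReal_eq_toReal_iff' hz.2.1.ne hu.2.1.ne, huμ] at heq
      have h2 := (ENNReal.toReal_le_toReal (energy_lt_top h hu).ne (energy_lt_top h hz).ne).2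
        (hmin z hz heq)
      rwa [energy, energy, ENNReal.toReal_add hu.2.2.1.ne hu.2.2.2.ne,
        ENNReal.toReal_add hz.2.2.1.ne hz.2.2.2.ne] at h2)
    (hμ.trans_le hlow)
  refine ⟨_, div_nonneg (add_nonneg ?_ ?_) (hμ.trans_le hlow).le, key⟩
  · exact le_trans ENNReal.toReal_nonneg
      (h.toReal_measModular_le_integral (aemeasurable_holderQuot hu.1 S) hu.2.2.1)
  · exact le_trans ENNReal.toReal_nonneg
      (h.toReal_measModular_le_integral (hu.1.mono_ac hm) hu.2.2.2)

end Minimizer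

/-! ### Admissible functions at every level -/

section Bump

variable {n : ℕ} {g : ℝ → ℝ} {pm pp s : ℝ}

/-- A radial kernel dominating the energy density of a Lipschitz bump. -/
noncomputable def bumpKernel (n : ℕ) (s d : ℝ) : ℝ :=
  (if d < 1 then d ^ (1 - s) else d ^ (-s)) / d ^ n

lemma measurable_bumpKernel : Measurable (bumpKernel n s) := by
  unfold bumpKernel
  refine Measurable.div ?_ (by fun_prop)
  exact Measurable.ite measurableSet_Iio (by fun_prop) (by fun_prop)

/-- In polar coordinates the kernel becomes `y ^ (-s)` below `1` and `y ^ (-s - 1)` above; the first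
is integrable since `s < 1`, the second since `s > 0`. -/
lemma integrable_bumpKernel_norm (hn : 1 ≤ n) (hs0 : 0 < s) (hs1 : s < 1) :
    Integrable (fun x : Rn n => bumpKernel n s ‖x‖) volume := by
  have : Nonempty (Fin n) := ⟨⟨0, hn⟩⟩
  rw [integrable_fun_norm_addHaar (volume : Measure (Rn n)) (f := bumpKernel n s),
    finrank_euclideanSpace_fin]
  have e : ∀ y : ℝ, 0 < y → y ^ (n - 1) • bumpKernel n s y =
      if y < 1 then y ^ (-s) else y ^ (-s - 1) := by
    intro y hy
    have hyn : y ^ n = y ^ (n - 1) * y := by rw [← pow_succ, Nat.sub_add_cancel hn]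
    have h0 : y ^ (n - 1) ≠ 0 := by positivity
    rw [bumpKernel, hyn, smul_eq_mul]
    split_ifs with h
    · rw [sub_eq_add_neg, Real.rpow_add hy, Real.rpow_one]
      field_simp
    · rw [Real.rpow_sub_one hy.ne']
      field_simp
  have h1 : IntegrableOn (fun y : ℝ => y ^ (-s)) (Ioo 0 1) := by
    have := intervalIntegral.intervalIntegrable_rpow' (a := 0) (b := 1) (r := -s) (by linarith)
    rw [intervalIntegrable_iff_integrableOn_Ioo_of_le zero_le_one] at this
    exact this
  have h2 : IntegrableOn (fun y : ℝ => y ^ (-s - 1)) (Ici 1) := by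
    rw [integrableOn_Ici_iff_integrableOn_Ioi]
    exact integrableOn_Ioi_rpow_of_lt (by linarith) one_pos
  rw [← Ioo_union_Ici_eq_Ioi (zero_lt_one' ℝ)]
  refine IntegrableOn.union (h1.congr_fun (fun y hy => ?_) measurableSet_Ioo)
    (h2.congr_fun (fun y hy => ?_) measurableSet_Ici)
  · simp only [e y hy.1, if_pos hy.2]
  · simp only [e y (one_pos.trans_le hy), if_neg (not_lt.2 (mem_Ici.1 hy))]

/-- The cone-shaped bump of radius `r` at `x₀`. -/
noncomputable def coneBump (x₀ : Rn n) (r : ℝ) (x : Rn n) : ℝ := max 0 (r - ‖x - x₀‖)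

lemma continuous_coneBump (x₀ : Rn n) (r : ℝ) : Continuous (coneBump x₀ r) := by
  unfold coneBump
  fun_prop

lemma coneBump_nonneg (x₀ : Rn n) (r : ℝ) (x : Rn n) : 0 ≤ coneBump x₀ r x := le_max_left _ _

lemma coneBump_le {r : ℝ} (hr : 0 ≤ r) (x₀ x : Rn n) : coneBump x₀ r x ≤ r :=
  max_le hr (by linarith [norm_nonneg (x - x₀)])

lemma coneBump_eq_zero {x₀ : Rn n} {r : ℝ} {x : Rn n} (hx : x ∉ Metric.ball x₀ r) :
    coneBump x₀ r x = 0 := by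
  rw [Metric.mem_ball, not_lt, dist_eq_norm] at hx
  exact max_eq_left (by linarith)

lemma abs_coneBump_sub_le (x₀ : Rn n) (r : ℝ) (x y : Rn n) :
    |coneBump x₀ r x - coneBump x₀ r y| ≤ ‖x - y‖ := by
  refine (abs_max_sub_max_le_max _ _ _ _).trans ?_
  rw [sub_self, abs_zero, max_eq_right (abs_nonneg _), sub_sub_sub_cancel_left]
  refine (abs_norm_sub_norm_le _ _).trans_eq ?_
  rw [sub_sub_sub_cancel_right, norm_sub_rev]

/-- At distances below `1` the bump is used as a `1`-Lipschitz function, at larger ones as a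
function with values in `[0, r]`. In both cases the remaining power of the distance is at most `1`
and leaves `G` by convexity. -/
lemma evenYoung_holderQuot_coneBump_le (h : IsRegularDensity g pm pp) (hs0 : 0 < s) (hs1 : s < 1)
    {r : ℝ} (hr : 0 < r) (x₀ : Rn n) (p : Rn n × Rn n) :
    1 / ‖p.1 - p.2‖ ^ n * evenYoung g (holderQuot s (coneBump x₀ r) p) ≤
      (evenYoung g 1 + evenYoung g r) * bumpKernel n s ‖p.1 - p.2‖ := by
  have hY1 := h.evenYoung_nonneg 1
  have hYr := h.evenYoung_nonneg r
  rcases (norm_nonneg (p.1 - p.2)).eq_or_lt with h0 | h0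
  · have : p.1 = p.2 := sub_eq_zero.1 (norm_eq_zero.1 h0.symm)
    have h2 : holderQuot s (coneBump x₀ r) p = 0 := by simp [holderQuot, this]
    rw [h2, evenYoung_zero, mul_zero, ← h0, bumpKernel, if_pos one_pos,
      Real.zero_rpow (by linarith)]
    simp
  set d := ‖p.1 - p.2‖ with hd
  have hds : 0 < d ^ s := Real.rpow_pos_of_pos h0 s
  rw [bumpKernel, ← mul_div_assoc, div_mul_eq_mul_div, one_mul]
  refine div_le_div_of_nonneg_right ?_ (by positivity)
  have habs : |holderQuot s (coneBump x₀ r) p| =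
      |coneBump x₀ r p.1 - coneBump x₀ r p.2| / d ^ s := by
    rw [holderQuot, abs_div, abs_of_pos hds]
  split_ifs with h1
  · have h2 : |holderQuot s (coneBump x₀ r) p| ≤ |d ^ (1 - s) * 1| := by
      rw [habs, mul_one, abs_of_pos (Real.rpow_pos_of_pos h0 _), div_le_iff₀ hds,
        ← Real.rpow_add h0, sub_add_cancel, Real.rpow_one]
      exact abs_coneBump_sub_le _ _ _ _
    have h3 := h.evenYoung_mul_le (Real.rpow_nonneg h0.le (1 - s))
      (Real.rpow_le_one h0.le h1.le (by linarith)) 1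
    have h4 := h.evenYoung_le_of_abs_le h2
    have h5 : 0 ≤ evenYoung g r * d ^ (1 - s) := by positivity
    nlinarith
  · have h1 : 1 ≤ d := not_lt.1 h1
    have h2 : |holderQuot s (coneBump x₀ r) p| ≤ |d ^ (-s) * r| := by
      rw [habs, abs_of_nonneg (mul_nonneg (Real.rpow_nonneg h0.le (-s)) hr.le),
        Real.rpow_neg h0.le, div_eq_inv_mul]
      gcongr
      rw [abs_le]
      constructor
      · linarith [coneBump_nonneg x₀ r p.1, coneBump_le hr.le x₀ p.2]
      · linarith [coneBump_nonneg x₀ r p.2, coneBump_le hr.le x₀ p.1]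
    have h3 := h.evenYoung_mul_le (Real.rpow_nonneg h0.le (-s))
      (Real.rpow_le_one_of_one_le_of_nonpos h1 (by linarith)) r
    have h4 := h.evenYoung_le_of_abs_le h2
    have h5 : 0 ≤ evenYoung g 1 * d ^ (-s) := by positivity
    nlinarith

/-- The integrand vanishes unless one of the two points lies in the ball. By translation invariance
each of the two cases contributes at most the volume of the ball times the integral of the kernel.
-/
lemma pairModular_coneBump_lt_top (h : IsRegularDensity g pm pp) (hn : 1 ≤ n) (hs0 : 0 < s)
    (hs1 : s < 1) {r : ℝ} (hr : 0 < r) (x₀ : Rn n) :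
    pairModular g s univ (coneBump x₀ r) < ∞ := by
  set B := Metric.ball x₀ r
  have hB : MeasurableSet B := Metric.isOpen_ball.measurableSet
  set κ : Rn n → ℝ≥0∞ := fun x =>
    ENNReal.ofReal ((evenYoung g 1 + evenYoung g r) * bumpKernel n s ‖x‖) with hκ
  have hκm : Measurable κ :=
    ((measurable_bumpKernel.comp measurable_norm).const_mul _).ennreal_ofReal
  have hκi : ∫⁻ x, κ x < ∞ :=
    ((integrable_bumpKernel_norm hn hs0 hs1).const_mul
      (evenYoung g 1 + evenYoung g r)).lintegral_lt_top
  have hm : Measurable fun x : Rn n => B.indicator (1 : Rn n → ℝ≥0∞) x :=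
    measurable_one.indicator hB
  have hκ2 : Measurable fun p : Rn n × Rn n => κ (p.1 - p.2) :=
    hκm.comp (measurable_fst.sub measurable_snd)
  have hm1 : Measurable fun p : Rn n × Rn n => B.indicator 1 p.1 * κ (p.1 - p.2) :=
    (hm.comp measurable_fst).mul hκ2
  have hm2 : Measurable fun p : Rn n × Rn n => B.indicator 1 p.2 * κ (p.1 - p.2) :=
    (hm.comp measurable_snd).mul hκ2
  have hfin : (∫⁻ x, B.indicator (1 : Rn n → ℝ≥0∞) x) * ∫⁻ x, κ x < ∞ := by
    rw [lintegral_indicator_one hB]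
    exact ENNReal.mul_lt_top measure_ball_lt_top hκi
  rw [pairModular_eq_lintegral h MeasurableSet.univ (continuous_coneBump x₀ r).aemeasurable,
    Measure.restrict_univ]
  calc _ ≤ ∫⁻ p : Rn n × Rn n, (B.indicator 1 p.1 * κ (p.1 - p.2) +
          B.indicator 1 p.2 * κ (p.1 - p.2)) := by
        refine lintegral_mono fun p => ?_
        by_cases hp : p.1 ∈ B ∨ p.2 ∈ B
        · have h1 : κ (p.1 - p.2) ≤ B.indicator 1 p.1 * κ (p.1 - p.2) +
              B.indicator 1 p.2 * κ (p.1 - p.2) := by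
            rcases hp with hp | hp
            · rw [indicator_of_mem hp]; simp
            · rw [indicator_of_mem hp]; simp
          refine le_trans ?_ h1
          rw [← ENNReal.ofReal_mul (by positivity)]
          exact ENNReal.ofReal_le_ofReal
            (evenYoung_holderQuot_coneBump_le h hs0 hs1 hr x₀ p)
        · rw [not_or] at hp
          have : holderQuot s (coneBump x₀ r) p = 0 := by
            simp [holderQuot, coneBump_eq_zero hp.1, coneBump_eq_zero hp.2]
          simp [this, evenYoung_zero]
    _ = (∫⁻ x, B.indicator (1 : Rn n → ℝ≥0∞) x) * (∫⁻ x, κ x) +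
          (∫⁻ x, B.indicator (1 : Rn n → ℝ≥0∞) x) * (∫⁻ x, κ x) := by
        rw [lintegral_add_left hm1, Measure.volume_eq_prod, lintegral_prod _ hm1.aemeasurable,
          lintegral_prod_symm _ hm2.aemeasurable]
        congr 1
        · rw [← lintegral_mul_const _ hm]
          refine lintegral_congr fun x => ?_
          have h3 : Measurable fun y => κ (x - y) := hκm.comp (by fun_prop)
          refine (lintegral_const_mul (B.indicator (1 : Rn n → ℝ≥0∞) x) h3).trans ?_
          congr 1
          exact lintegral_sub_left_eq_self κ x
        · rw [← lintegral_mul_const _ hm]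
          refine lintegral_congr fun y => ?_
          have h3 : Measurable fun x => κ (x - y) := hκm.comp (by fun_prop)
          refine (lintegral_const_mul (B.indicator (1 : Rn n → ℝ≥0∞) y) h3).trans ?_
          congr 1
          exact lintegral_sub_right_eq_self κ y
    _ < ∞ := ENNReal.add_lt_top.2 ⟨hfin, hfin⟩

/-- Every level set contains a function supported in `Ω`. -/
lemma exists_mem_level (h : IsRegularDensity g pm pp) (hn : 1 ≤ n) (hs0 : 0 < s) (hs1 : s < 1)
    {Ω : Set (Rn n)} (hΩo : IsOpen Ω) (hΩb : Bornology.IsBounded Ω) (hΩne : Ω.Nonempty)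
    {S : Set (Rn n × Rn n)} {m : Measure (Rn n)} (hm : m ≪ volume) (hmΩ : m Ω = 0) {μ : ℝ}
    (hμ : 0 < μ) :
    ∃ w ∈ energySpace h s Ω S hm, measModular g (volume.restrict Ω) w = ENNReal.ofReal μ := by
  obtain ⟨x₀, hx₀⟩ := hΩne
  obtain ⟨r, hr, hrΩ⟩ := Metric.isOpen_iff.1 hΩo x₀ hx₀
  set w := coneBump x₀ r
  have hwc : Continuous w := continuous_coneBump x₀ r
  have hΩt : volume Ω < ∞ := hΩb.measure_lt_top
  have hwΩ : measModular g (volume.restrict Ω) w < ∞ := by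
    refine (h.measModular_mono (k := fun _ => r) fun x => ?_).trans_lt
      ((measModular_const Ω r).trans_lt (ENNReal.mul_lt_top ENNReal.ofReal_lt_top hΩt))
    rw [abs_of_nonneg (coneBump_nonneg _ _ _), abs_of_pos hr]
    exact coneBump_le hr.le _ _
  have hwm : measModular g m w = 0 := by
    have : w =ᵐ[m] 0 := by
      refine measure_mono_null (fun x hx => ?_) hmΩ
      by_contra hxΩ
      exact hx (coneBump_eq_zero fun hxB => hxΩ (hrΩ hxB))
    rw [measModular_congr this, measModular_zero]
  have hwX : w ∈ energySpace h s Ω S hm :=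
    ⟨hwc.aemeasurable, hwΩ, (lintegral_mono_set (subset_univ S)).trans_lt
      (pairModular_coneBump_lt_top h hn hs0 hs1 hr x₀), hwm.trans_lt ENNReal.zero_lt_top⟩
  have hpos : 0 < measModular g (volume.restrict Ω) w := by
    rw [pos_iff_ne_zero]
    intro h0
    rw [measModular, lintegral_eq_zero_iff' (h.aemeasurable_ofReal hwc.aemeasurable)] at h0
    have h1 : volume (Metric.ball x₀ r) = 0 := by
      rw [EventuallyEq, ae_restrict_iff' hΩo.measurableSet] at h0
      refine measure_mono_null (fun x hx => ?_) h0
      simp only [mem_compl_iff, mem_ofPred_eq, Classical.not_imp, Pi.zero_apply,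
        ENNReal.ofReal_eq_zero, not_le]
      refine ⟨hrΩ hx, h.evenYoung_pos (ne_of_gt (lt_max_of_lt_right ?_))⟩
      rw [Metric.mem_ball, dist_eq_norm] at hx
      linarith
    exact (Metric.measure_ball_pos volume x₀ hr).ne' h1
  set I := (measModular g (volume.restrict Ω) w).toReal with hI
  have hIpos : 0 < I := ENNReal.toReal_pos hpos.ne' hwΩ.ne
  -- For `T ≥ 1` convexity gives `G(T w) ≥ T G(w)`, so this factor lifts the bump to level at least
  -- `μ`; a further contraction then hits `μ` exactly.
  set T := max 1 (μ / I)
  have hT : ENNReal.ofReal μ ≤ measModular g (volume.restrict Ω) (T • w) := by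
    refine le_trans ?_ (h.le_measModular_smul (le_max_left _ _) w)
    rw [← ENNReal.ofReal_toReal hwΩ.ne, ← ENNReal.ofReal_mul (by positivity)]
    refine ENNReal.ofReal_le_ofReal ?_
    calc μ = μ / I * I := by field_simp
      _ ≤ T * I := by gcongr; exact le_max_right _ _
  have hTX := (energySpace h s Ω S hm).smul_mem T hwX
  obtain ⟨c, -, hc⟩ := h.exists_smul_measModular_eq hTX.1.restrict hTX.2.1 hμ.le hT
  exact ⟨c • T • w, (energySpace h s Ω S hm).smul_mem c hTX, hc⟩

end Bump

/-! ### The four eigenvalue problems -/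

section Problems

variable {n : ℕ} {g : ℝ → ℝ} {pm pp s : ℝ} {Ω : Set (Rn n)}

lemma holderQuot_const (c : ℝ) (p : Rn n × Rn n) : holderQuot s (fun _ => c) p = 0 := by
  simp [holderQuot]

lemma pairModular_const (S : Set (Rn n × Rn n)) (c : ℝ) :
    pairModular g s S (fun _ => c) = 0 := by
  simp [pairModular_eq, measModular, holderQuot_const, evenYoung_zero]

lemma pairForm_const (S : Set (Rn n × Rn n)) (c : ℝ) (v : Rn n → ℝ) :
    pairForm g s S (fun _ => c) v = 0 := by
  simp [pairForm, holderQuot_const, oddExt_zero]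

lemma exists_const_modular_eq (h : IsRegularDensity g pm pp) (hΩo : IsOpen Ω)
    (hΩb : Bornology.IsBounded Ω) (hΩne : Ω.Nonempty) {μ : ℝ} (hμ : 0 < μ) :
    ∃ c : ℝ, 0 ≤ c ∧ modular g Ω (fun _ => c) = ENNReal.ofReal μ := by
  have hΩ0 : volume Ω ≠ 0 := (hΩo.measure_pos volume hΩne).ne'
  have hΩt : volume Ω ≠ ∞ := hΩb.measure_lt_top.ne
  have hV : 0 < (volume Ω).toReal := ENNReal.toReal_pos hΩ0 hΩt
  obtain ⟨c, hc⟩ := mem_range_of_exists_le_of_exists_ge h.continuous_evenYoung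
    (c := μ / (volume Ω).toReal) ⟨0, by rw [evenYoung_zero]; positivity⟩
    (h.tendsto_evenYoung.eventually (eventually_ge_atTop _)).exists
  refine ⟨|c|, abs_nonneg c, (measModular_const Ω |c|).trans ?_⟩
  rw [evenYoung_abs, hc]
  nth_rewrite 2 [← ENNReal.ofReal_toReal hΩt]
  rw [← ENNReal.ofReal_mul (by positivity), div_mul_cancel₀ _ hV.ne']

/-- The Neumann problem: the seminorm vanishes on constants, which lie in the space because `Ω` is
bounded, so the constant at level `μ` is a minimizer and the first eigenvalue is `1`. -/
theorem exists_neumann_solution (h : IsRegularDensity g pm pp) (hΩo : IsOpen Ω)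
    (hΩb : Bornology.IsBounded Ω) (hΩne : Ω.Nonempty) {μ : ℝ} (hμ : 0 < μ) :
    ∃ (lam : ℝ) (u : Rn n → ℝ), 0 < lam ∧ IsNeumannEigenpair g s Ω lam u ∧ (∀ x, 0 ≤ u x) ∧
      modular g Ω u = ENNReal.ofReal μ ∧ IsNeumannMinimizer g s Ω μ u := by
  obtain ⟨c, hc0, hc⟩ := exists_const_modular_eq h hΩo hΩb hΩne hμ
  have hmem : (fun _ => c) ∈ neumannSpace g s Ω := ⟨aemeasurable_const,
    hc.trans_lt ENNReal.ofReal_lt_top, (pairModular_const _ c).trans_lt ENNReal.zero_lt_top⟩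
  refine ⟨1, fun _ => c, one_pos, ⟨hmem, fun v _ => ?_⟩, fun _ => hc0, hc, ⟨hmem, hc⟩,
    fun w hw => ?_⟩
  · rw [starPairing, pairForm_const]
    ring
  · simp only [mem_ofPred_eq, pairModular_const, hc, hw.2]
    gcongr
    exact zero_le

/-- The regional Neumann problem: as for the Neumann problem, the minimizer is a constant. -/
theorem exists_regional_solution (h : IsRegularDensity g pm pp) (hΩo : IsOpen Ω)
    (hΩb : Bornology.IsBounded Ω) (hΩne : Ω.Nonempty) {μ : ℝ} (hμ : 0 < μ) :
    ∃ (lam : ℝ) (u : Rn n → ℝ), 0 < lam ∧ IsRegionalEigenpair g s Ω lam u ∧ (∀ x, 0 ≤ u x) ∧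
      modular g Ω u = ENNReal.ofReal μ ∧ IsRegionalMinimizer g s Ω μ u := by
  obtain ⟨c, hc0, hc⟩ := exists_const_modular_eq h hΩo hΩb hΩne hμ
  have hmem : (fun _ => c) ∈ regionalSpace g s Ω := ⟨aemeasurable_const,
    hc.trans_lt ENNReal.ofReal_lt_top, (pairModular_const _ c).trans_lt ENNReal.zero_lt_top⟩
  refine ⟨1, fun _ => c, one_pos, ⟨hmem, fun v _ => ?_⟩, fun _ => hc0, hc, ⟨hmem, hc⟩,
    fun w hw => ?_⟩
  · rw [regPairing, pairForm_const]
    ring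
  · simp only [mem_ofPred_eq, pairModular_const, hc, hw.2]
    gcongr
    exact zero_le

/-- The measure that forces functions of finite energy to vanish outside `Ω`. -/
noncomputable def dirichletMeasure (Ω : Set (Rn n)) : Measure (Rn n) :=
  (∞ : ℝ≥0∞) • volume.restrict Ωᶜ

lemma dirichletMeasure_ac : dirichletMeasure Ω ≪ volume.restrict Ωᶜ :=
  Measure.smul_absolutelyContinuous

lemma dirichletMeasure_ac' : volume.restrict Ωᶜ ≪ dirichletMeasure Ω := by
  intro A hA
  rw [dirichletMeasure, Measure.smul_apply, smul_eq_mul, mul_eq_zero] at hA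
  exact hA.resolve_left ENNReal.top_ne_zero

lemma measModular_dirichletMeasure_eq_zero {u : Rn n → ℝ}
    (hu : ∀ᵐ x ∂(volume.restrict Ωᶜ), u x = 0) : measModular g (dirichletMeasure Ω) u = 0 := by
  have : u =ᵐ[dirichletMeasure Ω] 0 := dirichletMeasure_ac.ae_le hu
  rw [measModular_congr this, measModular_zero]

lemma ae_eq_zero_of_measModular_dirichletMeasure (h : IsRegularDensity g pm pp) {u : Rn n → ℝ}
    (hum : AEMeasurable u volume) (hu : measModular g (dirichletMeasure Ω) u < ∞) :
    ∀ᵐ x ∂(volume.restrict Ωᶜ), u x = 0 := by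
  rw [measModular, dirichletMeasure, lintegral_smul_measure, smul_eq_mul] at hu
  have h0 : ∫⁻ x in Ωᶜ, ENNReal.ofReal (evenYoung g (u x)) = 0 := by
    by_contra hne
    rw [ENNReal.top_mul hne] at hu
    exact lt_irrefl _ hu
  rw [lintegral_eq_zero_iff' (h.aemeasurable_ofReal hum.restrict)] at h0
  filter_upwards [h0] with x hx
  by_contra hne
  exact absurd (ENNReal.ofReal_eq_zero.1 hx) (not_le.2 (h.evenYoung_pos hne))

/-- A modular for `∞ · dx` is either `0` or `∞`, so its finiteness is exactly vanishing a.e. outside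
`Ω`; the modular over `ℝⁿ` then reduces to the one over `Ω`. -/
lemma mem_energySpace_dirichlet_iff (h : IsRegularDensity g pm pp) (hΩ : MeasurableSet Ω)
    (hm : dirichletMeasure Ω ≪ volume) {u : Rn n → ℝ} :
    u ∈ energySpace h s Ω univ hm ↔ u ∈ dirichletSpace g s Ω := by
  constructor
  · rintro ⟨h1, h2, h3, h4⟩
    have h5 := ae_eq_zero_of_measModular_dirichletMeasure h h1 h4
    refine ⟨h1, ?_, h3, h5⟩
    have h6 : measModular g volume u = measModular g (volume.restrict Ω) u +
        measModular g (volume.restrict Ωᶜ) u := (lintegral_add_compl _ hΩ).symm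
    have h7 : measModular g (volume.restrict Ωᶜ) u = 0 := by
      rw [measModular_congr (h := 0) h5, measModular_zero]
    rw [h7, add_zero] at h6
    rw [modular, Measure.restrict_univ]
    exact h6.trans_lt h2
  · rintro ⟨h1, h2, h3, h4⟩
    exact ⟨h1, (lintegral_mono_set (subset_univ Ω)).trans_lt h2, h3,
      (measModular_dirichletMeasure_eq_zero h4).trans_lt ENNReal.zero_lt_top⟩

/-- The exterior term of the general problem is zero on the Dirichlet space, both in the energy and
in the Euler-Lagrange equation. What remains is the Dirichlet equation with `lam - 1` equal to the
multiplier. -/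
theorem exists_dirichlet_solution (h : IsRegularDensity g pm pp) (hn : 1 ≤ n) (hs0 : 0 < s)
    (hs1 : s < 1) (hΩo : IsOpen Ω) (hΩb : Bornology.IsBounded Ω) (hΩne : Ω.Nonempty) {μ : ℝ}
    (hμ : 0 < μ) :
    ∃ (lam : ℝ) (u : Rn n → ℝ), 0 < lam ∧ IsDirichletEigenpair g s Ω lam u ∧ (∀ x, 0 ≤ u x) ∧
      modular g Ω u = ENNReal.ofReal μ ∧ IsDirichletMinimizer g s Ω μ u := by
  have hm : dirichletMeasure Ω ≪ volume :=
    dirichletMeasure_ac.trans Measure.absolutelyContinuous_restrict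
  have hmΩ : dirichletMeasure Ω Ω = 0 := dirichletMeasure_ac (by
    rw [Measure.restrict_apply hΩo.measurableSet, inter_compl_self, measure_empty])
  obtain ⟨u, hu, hu0, huμ, hmin⟩ := exists_energy_minimizer (S := univ) h hs0 hΩo.measurableSet hΩb
    (subset_univ _) hm dirichletMeasure_ac'
    (exists_mem_level h hn hs0 hs1 hΩo hΩb hΩne hm hmΩ hμ)
  obtain ⟨L, hL, hEL⟩ := exists_multiplier_of_minimizer h hm hμ hu huμ hmin
  have hiff : ∀ {w : Rn n → ℝ}, w ∈ energySpace h s Ω univ hm ↔ w ∈ dirichletSpace g s Ω :=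
    mem_energySpace_dirichlet_iff h hΩo.measurableSet hm
  have hE : ∀ w ∈ dirichletSpace g s Ω,
      energy g s univ (dirichletMeasure Ω) w = pairModular g s univ w := fun w hw => by
    rw [energy, measModular_dirichletMeasure_eq_zero hw.2.2.2, add_zero]
  have huD := hiff.1 hu
  refine ⟨L + 1, u, by linarith, ⟨huD, fun v hv => ?_⟩, hu0, huμ, ⟨huD, huμ⟩, fun w hw => ?_⟩
  · have h1 := hEL v (hiff.2 hv)
    have h2 : ∫ x, oddExt g (u x) * v x ∂(dirichletMeasure Ω) = 0 := by
      refine integral_eq_zero_of_ae (dirichletMeasure_ac.ae_le ?_)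
      filter_upwards [huD.2.2.2] with x hx
      simp [hx, oddExt_zero]
    rw [h2, add_zero] at h1
    rw [fullPairing, h1]
    ring
  · have h1 := hmin w (hiff.2 hw.1) hw.2
    rw [hE u huD, hE w hw.1] at h1
    have h2 : modular g Ω u = ENNReal.ofReal μ := huμ
    simp only [mem_ofPred_eq, h2, hw.2]
    gcongr

/-- The weighted exterior measure of the Robin problem. -/
noncomputable def robinMeasure (β : Rn n → ℝ) (Ω : Set (Rn n)) : Measure (Rn n) :=
  (volume.restrict Ωᶜ).withDensity fun x => ENNReal.ofReal (2 * β x)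

lemma measModular_robinMeasure (h : IsRegularDensity g pm pp) {β : Rn n → ℝ}
    (hβ : AEMeasurable β (volume.restrict Ωᶜ)) {u : Rn n → ℝ} (hu : AEMeasurable u volume) :
    measModular g (robinMeasure β Ω) u = weightedModular g (fun x => 2 * β x) Ωᶜ u := by
  rw [measModular, robinMeasure, lintegral_withDensity_eq_lintegral_mul₀
    (hβ.const_mul 2).ennreal_ofReal (h.aemeasurable_ofReal hu.restrict)]
  refine lintegral_congr fun x => ?_
  rw [Pi.mul_apply, ← ENNReal.ofReal_mul' (h.evenYoung_nonneg _)]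
  rfl

lemma weightedModular_two_mul (β : Rn n → ℝ) (A : Set (Rn n)) (u : Rn n → ℝ) :
    weightedModular g (fun x => 2 * β x) A u = 2 * weightedModular g β A u := by
  rw [weightedModular, weightedModular, ← lintegral_const_mul' _ _ (by simp)]
  refine lintegral_congr fun x => ?_
  rw [mul_assoc, ENNReal.ofReal_mul two_pos.le, ENNReal.ofReal_ofNat]

lemma integral_robinMeasure {β : Rn n → ℝ} (hβ : AEMeasurable β (volume.restrict Ωᶜ))
    (hβ0 : ∀ᵐ x ∂(volume.restrict Ωᶜ), 0 < β x) (u v : Rn n → ℝ) :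
    ∫ x, oddExt g (u x) * v x ∂(robinMeasure β Ω) = 2 * weightedForm g β Ωᶜ u v := by
  rw [robinMeasure, integral_withDensity_eq_integral_toReal_smul₀
    (hβ.const_mul 2).ennreal_ofReal (Eventually.of_forall fun x => ENNReal.ofReal_lt_top),
    weightedForm, ← integral_const_mul]
  refine integral_congr_ae ?_
  filter_upwards [hβ0] with x hx
  rw [ENNReal.toReal_ofReal (by positivity), smul_eq_mul]
  ring

/-- The weak Robin equation carries `1/2` on the nonlocal form but not on the exterior term, so the
functional to minimize has weight `2β`. Halving its Euler-Lagrange equation gives `lam - 1 = L / 2`.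
-/
theorem exists_robin_solution (h : IsRegularDensity g pm pp) (hn : 1 ≤ n) (hs0 : 0 < s)
    (hs1 : s < 1) (hΩo : IsOpen Ω) (hΩb : Bornology.IsBounded Ω) (hΩne : Ω.Nonempty)
    {β : Rn n → ℝ} (hβ : AEMeasurable β (volume.restrict Ωᶜ))
    (hβ0 : ∀ᵐ x ∂(volume.restrict Ωᶜ), 0 < β x) {μ : ℝ} (hμ : 0 < μ) :
    ∃ (lam : ℝ) (u : Rn n → ℝ), 0 < lam ∧ IsRobinEigenpair g s β Ω lam u ∧ (∀ x, 0 ≤ u x) ∧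
      modular g Ω u = ENNReal.ofReal μ ∧ IsRobinMinimizer g s (fun x => 2 * β x) Ω μ u := by
  have hac : robinMeasure β Ω ≪ volume.restrict Ωᶜ := withDensity_absolutelyContinuous _ _
  have hac' : volume.restrict Ωᶜ ≪ robinMeasure β Ω := by
    refine withDensity_absolutelyContinuous' (hβ.const_mul 2).ennreal_ofReal ?_
    filter_upwards [hβ0] with x hx
    exact (ENNReal.ofReal_pos.2 (by positivity)).ne'
  have hm : robinMeasure β Ω ≪ volume := hac.trans Measure.absolutelyContinuous_restrict
  have hmΩ : robinMeasure β Ω Ω = 0 := hac (by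
    rw [Measure.restrict_apply hΩo.measurableSet, inter_compl_self, measure_empty])
  obtain ⟨u, hu, hu0, huμ, hmin⟩ := exists_energy_minimizer (S := starSet Ω) h hs0
    hΩo.measurableSet hΩb subset_rfl hm hac'
    (exists_mem_level h hn hs0 hs1 hΩo hΩb hΩne hm hmΩ hμ)
  obtain ⟨L, hL, hEL⟩ := exists_multiplier_of_minimizer h hm hμ hu huμ hmin
  have hiff : ∀ {w : Rn n → ℝ}, w ∈ energySpace h s Ω (starSet Ω) hm ↔
      w ∈ robinSpace g s (fun x => 2 * β x) Ω := by
    intro w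
    constructor
    · rintro ⟨h1, h2, h3, h4⟩
      exact ⟨h1, h2, h3, (measModular_robinMeasure h hβ h1).symm.trans_lt h4⟩
    · rintro ⟨h1, h2, h3, h4⟩
      exact ⟨h1, h2, h3, (measModular_robinMeasure h hβ h1).trans_lt h4⟩
  have hiff' : ∀ {w : Rn n → ℝ}, w ∈ robinSpace g s (fun x => 2 * β x) Ω ↔
      w ∈ robinSpace g s β Ω := by
    intro w
    simp only [robinSpace, mem_ofPred_eq, weightedModular_two_mul]
    rw [ENNReal.mul_lt_top_iff]
    constructor
    · rintro ⟨h1, h2, h3, h4⟩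
      refine ⟨h1, h2, h3, ?_⟩
      rcases h4 with h4 | h4 | h4
      · exact h4.2
      · simp at h4
      · rw [h4]; exact ENNReal.zero_lt_top
    · rintro ⟨h1, h2, h3, h4⟩
      exact ⟨h1, h2, h3, Or.inl ⟨by simp, h4⟩⟩
  have huR := hiff.1 hu
  refine ⟨L / 2 + 1, u, by linarith, ⟨hiff'.1 huR, fun v hv => ?_⟩, hu0, huμ, ⟨huR, huμ⟩,
    fun w hw => ?_⟩
  · have h1 := hEL v (hiff.2 (hiff'.2 hv))
    rw [integral_robinMeasure hβ hβ0] at h1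
    rw [starPairing]
    linarith
  · have h1 := hmin w (hiff.2 hw.1) hw.2
    rw [energy, energy, measModular_robinMeasure h hβ hu.1,
      measModular_robinMeasure h hβ hw.1.1] at h1
    have h2 : modular g Ω u = ENNReal.ofReal μ := huμ
    simp only [mem_ofPred_eq, h2, hw.2]
    rw [add_right_comm, add_right_comm (pairModular g s (starSet Ω) w)]
    gcongr

end Problems

end FracOrlicz

theorem mainTheorem3
    (n : ℕ) (hn : 1 ≤ n) (s : ℝ) (hs0 : 0 < s) (hs1 : s < 1)
    (g : ℝ → ℝ) (hg : IsYoungDensity g) (hgc : ContinuousOn g (Ici 0))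
    (pm pp : ℝ) (hgrowth : GrowthCondition g pm pp)
    (Ω : Set (Rn n)) (hΩo : IsOpen Ω) (hΩb : Bornology.IsBounded Ω) (hΩne : Ω.Nonempty)
    (hΩL : HasLipschitzBoundary Ω)
    (β : Rn n → ℝ) (hβ : MemLp β ∞ (volume.restrict Ωᶜ))
    (hβpos : ∀ᵐ x ∂(volume.restrict Ωᶜ), 0 < β x)
    (μ : ℝ) (hμ : 0 < μ) :
    ∃ (lamD lamN lamNt lamR : ℝ) (uD uN uNt uR : Rn n → ℝ),
      (0 < lamD ∧ 0 < lamN ∧ 0 < lamNt ∧ 0 < lamR) ∧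
      (IsDirichletEigenpair g s Ω lamD uD ∧ IsNeumannEigenpair g s Ω lamN uN ∧
        IsRegionalEigenpair g s Ω lamNt uNt ∧ IsRobinEigenpair g s β Ω lamR uR) ∧
      ((∀ x, 0 ≤ uD x) ∧ (∀ x, 0 ≤ uN x) ∧ (∀ x, 0 ≤ uNt x) ∧ (∀ x, 0 ≤ uR x)) ∧
      (modular g Ω uD = ENNReal.ofReal μ ∧ modular g Ω uN = ENNReal.ofReal μ ∧
        modular g Ω uNt = ENNReal.ofReal μ ∧ modular g Ω uR = ENNReal.ofReal μ) ∧
      (IsDirichletMinimizer g s Ω μ uD ∧ IsNeumannMinimizer g s Ω μ uN ∧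
        IsRegionalMinimizer g s Ω μ uNt ∧ IsRobinMinimizer g s (fun x => 2 * β x) Ω μ uR) := by
  have h : IsRegularDensity g pm pp := ⟨hg, hgc, hgrowth⟩
  obtain ⟨lamD, uD, hD1, hD2, hD3, hD4, hD5⟩ :=
    exists_dirichlet_solution h hn hs0 hs1 hΩo hΩb hΩne hμ
  obtain ⟨lamN, uN, hN1, hN2, hN3, hN4, hN5⟩ := exists_neumann_solution (s := s) h hΩo hΩb hΩne hμ
  obtain ⟨lamT, uT, hT1, hT2, hT3, hT4, hT5⟩ := exists_regional_solution (s := s) h hΩo hΩb hΩne hμ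
  obtain ⟨lamR, uR, hR1, hR2, hR3, hR4, hR5⟩ :=
    exists_robin_solution h hn hs0 hs1 hΩo hΩb hΩne hβ.1.aemeasurable hβpos hμ
  exact ⟨lamD, lamN, lamT, lamR, uD, uN, uT, uR, ⟨hD1, hN1, hT1, hR1⟩, ⟨hD2, hN2, hT2, hR2⟩,
    ⟨hD3, hN3, hT3, hR3⟩, ⟨hD4, hN4, hT4, hR4⟩, hD5, hN5, hT5, hR5⟩
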